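/- Let $H$ and $U$ be complex Hilbert spaces. Let $A_1 : D(A_1)\subset H\to H$ be the generator of a $C_0$-semigroup $(S_{A_1}(t))_{t\ge 0}$ on $H$. Let $D(A_1^*)$ carry the graph norm, let $D(A_1^*)'$ be its (anti)dual with respect to the pivot space $H$, and let $B\in\mathcal L(U,D(A_1^*)')$ with adjoint $B^*\in\mathcal L(D(A_1^*),U)$. For a generator $A$ with $D(A^*)=D(A_1^*)$ with equivalent graph norms, and for $T\ge 0$, $u\in L^2(0,+\infty;U)$, put $$\Phi_{A}(T)u=\int_0^T S_{A}(T-s)Bu(s)\,ds\in D(A_1^*)',$$ that is, $\langle \Phi_A(T)u,z\rangle=\int_0^T\langle Bu(s),S_A(T-s)^*z\rangle\,ds$ for all $z\in D(A_1^*)$. Assume that $B$ is admissible for $A_1$, i.e. for some $T>0$ the range of $\Phi_{A_1}(T)$ is contained in $H$. Let $P\in\mathcal L(H)$ and $A_2=A_1+P$ with $D(A_2)=D(A_1)$. For $z^0\in H$ and $t\ge 0$ let $\tilde z(t)=S_{A_1}(t)^*z^0$ and $V\tilde z(t)=\int_0^t S_{A_1}(t-s)^*P^*\tilde z(s)\,ds$.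 Assume that for every $T>0$ there exist a Hilbert space $\widetilde H$, a compact operator $F\in\mathcal L(H,\widetilde H)$ and $C>0$ such that $$\int_0^T\|B^*V\tilde z(t)\|_U^2\,dt+\int_0^T\|V\tilde z(t)\|_H^2\,dt\le C\,\|Fz^0\|_{\widetilde H}^2\qquad\text{for all } z^0\in D(A_1^*).$$ Then $A_2$ generates a $C_0$-semigroup on $H$, $B$ is admissible for $A_2$ (where $D(A_2^*)=D(A_1^*)$ with equivalent graph norms), and for every $T>0$ the input maps $\Phi_i(T)=\Phi_{A_i}(T)$, $i=1,2$, are well-defined operators in $\mathcal L(L^2(0,+\infty;U),H)$ and $\Phi_1(T)^*-\Phi_2(T)^*$ is compact. -/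

import Mathlib

open MeasureTheory Set Filter Topology

namespace ControlSystem

noncomputable section

/-! ### Semigroups and generators -/

section Semigroup

variable {H : Type*} [NormedAddCommGroup H] [InnerProductSpace ℂ H]

/-- `S` (considered for times `t ≥ 0` only) is a `C₀`-semigroup of bounded operators on `H`. -/
structure IsC0Semigroup (S : ℝ → H →L[ℂ] H) : Prop where
  map_zero : S 0 = 1
  map_add : ∀ s t : ℝ, 0 ≤ s → 0 ≤ t → S (s + t) = S s * S t
  continuousOn : ∀ x : H, ContinuousOn (fun t => S t x) (Ici 0)

/-- `A` is the infinitesimal generator of `S`: `x ∈ D(A)` and `A x = y` if and only if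
`(S(t) x - x) / t → y` as `t → 0⁺`. -/
def IsGenerator (A : H →ₗ.[ℂ] H) (S : ℝ → H →L[ℂ] H) : Prop :=
  ∀ x y : H, (x, y) ∈ A.graph ↔
    Tendsto (fun t : ℝ => ((t⁻¹ : ℝ) : ℂ) • (S t x - x)) (𝓝[>] 0) (𝓝 y)

/-- The unbounded operator `A` generates a `C₀`-semigroup on `H`. -/
def GeneratesC0Semigroup (A : H →ₗ.[ℂ] H) : Prop :=
  ∃ S : ℝ → H →L[ℂ] H, IsC0Semigroup S ∧ IsGenerator A S

open scoped Classical in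
/-- The semigroup `S_A(t)`, `t ≥ 0`, generated by `A` (a `C₀`-semigroup is determined on `[0, ∞)`
by its generator). It is only meaningful if `A` generates a `C₀`-semigroup. -/
def semigroup (A : H →ₗ.[ℂ] H) : ℝ → H →L[ℂ] H :=
  if h : GeneratesC0Semigroup A then h.choose else 0

theorem semigroup_spec {A : H →ₗ.[ℂ] H} (h : GeneratesC0Semigroup A) :
    IsC0Semigroup (semigroup A) ∧ IsGenerator A (semigroup A) := by
  rw [semigroup, dif_pos h]
  exact h.choose_spec

end Semigroup

/-! ### The domain of an unbounded operator, with the graph norm -/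

section GraphDomain

variable {E F : Type*} [NormedAddCommGroup E] [InnerProductSpace ℂ E]
  [NormedAddCommGroup F] [InnerProductSpace ℂ F]

/-- The domain of an unbounded operator `A`; it is given the graph norm
`(‖x‖² + ‖A x‖²)^(1/2)` below. -/
def GraphDomain (A : E →ₗ.[ℂ] F) : Type _ := A.domain

instance (A : E →ₗ.[ℂ] F) : AddCommGroup (GraphDomain A) :=
  inferInstanceAs (AddCommGroup A.domain)

instance (A : E →ₗ.[ℂ] F) : Module ℂ (GraphDomain A) :=
  inferInstanceAs (Module ℂ A.domain)

/-- The inclusion `D(A) ⊆ E`. -/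
def GraphDomain.incl (A : E →ₗ.[ℂ] F) : GraphDomain A →ₗ[ℂ] E := A.domain.subtype

/-- The action of `A` on its domain. -/
def GraphDomain.op (A : E →ₗ.[ℂ] F) : GraphDomain A →ₗ[ℂ] F := A.toFun

/-- The map `x ↦ (x, A x)` into the Hilbert sum of `E` and `F`. -/
def GraphDomain.toGraph (A : E →ₗ.[ℂ] F) : GraphDomain A →ₗ[ℂ] WithLp 2 (E × F) :=
  (WithLp.linearEquiv 2 ℂ (E × F)).symm.toLinearMap ∘ₗ
    ((GraphDomain.incl A).prod (GraphDomain.op A))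

theorem GraphDomain.toGraph_injective (A : E →ₗ.[ℂ] F) :
    Function.Injective (GraphDomain.toGraph A) := by
  intro x y h
  have h' := congrArg (fun p : WithLp 2 (E × F) => p.fst) h
  exact Subtype.ext h'

instance (A : E →ₗ.[ℂ] F) : NormedAddCommGroup (GraphDomain A) :=
  NormedAddCommGroup.induced (GraphDomain A) (WithLp 2 (E × F)) (GraphDomain.toGraph A)
    (GraphDomain.toGraph_injective A)

instance (A : E →ₗ.[ℂ] F) : NormedSpace ℂ (GraphDomain A) :=
  NormedSpace.induced ℂ (GraphDomain A) (WithLp 2 (E × F)) (GraphDomain.toGraph A)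

theorem GraphDomain.norm_eq (A : E →ₗ.[ℂ] F) (z : GraphDomain A) :
    ‖z‖ = Real.sqrt (‖GraphDomain.incl A z‖ ^ 2 + ‖GraphDomain.op A z‖ ^ 2) := by
  change ‖GraphDomain.toGraph A z‖ = _
  rw [WithLp.prod_norm_eq_of_L2]
  rfl

open scoped Classical in
/-- An element of `E` that belongs to `D(A)`, as an element of `D(A)`. The value outside of `D(A)`
is irrelevant: below, this is only used at points of `D(A)`. -/
def GraphDomain.of (A : E →ₗ.[ℂ] F) (x : E) : GraphDomain A :=
  if h : x ∈ A.domain then (⟨x, h⟩ : A.domain) else (0 : A.domain)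

theorem GraphDomain.incl_of (A : E →ₗ.[ℂ] F) {x : E} (h : x ∈ A.domain) :
    GraphDomain.incl A (GraphDomain.of A x) = x := by
  have e : GraphDomain.of A x = (⟨x, h⟩ : A.domain) := dif_pos h
  exact congrArg (GraphDomain.incl A) e

end GraphDomain

/-! ### Control operators -/

section Control

variable {H U : Type*} [NormedAddCommGroup H] [InnerProductSpace ℂ H] [CompleteSpace H]
  [NormedAddCommGroup U] [InnerProductSpace ℂ U] [CompleteSpace U]

/-- The space `D(A*)'` of bounded antilinear functionals on `D(A*)`, the latter with the graph
norm. With `H` as pivot space, `y ∈ H` is identified with the functional `z ↦ ⟪z, y⟫`. -/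
abbrev AdjointDomainDual (A : H →ₗ.[ℂ] H) : Type _ :=
  GraphDomain A.adjoint →SL[starRingEnd ℂ] ℂ

/-- The adjoint `B* ∈ L(D(A*), U)` of a control operator `B ∈ L(U, D(A*)')`. -/
def controlAdjoint {A : H →ₗ.[ℂ] H} (B : U →L[ℂ] AdjointDomainDual A) :
    GraphDomain A.adjoint →L[ℂ] U :=
  ((InnerProductSpace.toDual ℂ U).symm.toContinuousLinearEquiv :
    (U →L[ℂ] ℂ) →SL[starRingEnd ℂ] U).comp B.flip

theorem inner_controlAdjoint {A : H →ₗ.[ℂ] H} (B : U →L[ℂ] AdjointDomainDual A)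
    (z : GraphDomain A.adjoint) (u : U) : inner ℂ (controlAdjoint B z) u = B u z := by
  change inner ℂ ((InnerProductSpace.toDual ℂ U).symm (B.flip z)) u = _
  rw [InnerProductSpace.toDual_symm_apply]
  rfl

/-- The adjoint semigroup maps `D(A*)` into itself. -/
theorem adjoint_semigroup_mem {A : H →ₗ.[ℂ] H} (hA : GeneratesC0Semigroup A) {t : ℝ} (ht : 0 ≤ t)
    {z : H} (hz : z ∈ A.adjoint.domain) :
    ContinuousLinearMap.adjoint (semigroup A t) z ∈ A.adjoint.domain := by
  obtain ⟨hS, hG⟩ := semigroup_spec hA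
  have key : ∀ x : A.domain, (semigroup A t x, semigroup A t (A x)) ∈ A.graph := by
    intro x
    rw [hG]
    have h1 := (hG x (A x)).1 (A.mem_graph x)
    have h2 := ((semigroup A t).continuous.tendsto (A x)).comp h1
    refine h2.congr' ?_
    filter_upwards [self_mem_nhdsWithin] with s hs
    have hs' : (0 : ℝ) ≤ s := le_of_lt hs
    have e : semigroup A s (semigroup A t x) = semigroup A t (semigroup A s x) := by
      have e1 := hS.map_add s t hs' ht
      have e2 := hS.map_add t s ht hs'
      rw [add_comm, e1] at e2
      exact congrArg (fun L : H →L[ℂ] H => L x) e2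
    simp [e]
  rw [LinearPMap.mem_adjoint_domain_iff] at hz ⊢
  have hmem : ∀ x : A.domain, semigroup A t x ∈ A.domain := fun x =>
    LinearPMap.mem_domain_of_mem_graph (key x)
  have hval : ∀ x : A.domain, A ⟨semigroup A t x, hmem x⟩ = semigroup A t (A x) := fun x =>
    ((LinearPMap.image_iff (hmem x)).2 (key x)).symm
  have hc : Continuous fun x : A.domain => (⟨semigroup A t x, hmem x⟩ : A.domain) :=
    Continuous.subtype_mk (by fun_prop) _
  have := hz.comp hc
  refine this.congr fun x => ?_
  change inner ℂ z (A ⟨semigroup A t x, hmem x⟩)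
    = inner ℂ (ContinuousLinearMap.adjoint (semigroup A t) z) (A x)
  rw [hval, ContinuousLinearMap.adjoint_inner_left]

/-! ### Input maps and admissibility -/

/-- The space `L²(0, +∞; U)`. -/
abbrev InputSpace (U : Type*) [NormedAddCommGroup U] : Type _ :=
  Lp U 2 (volume.restrict (Ioi (0 : ℝ)))

/-- The element `∫_0^T S_A(T-s) B u(s) ds` of `D(A*)'`, tested against `z ∈ D(A*)`. Here `S_A(t)`
acts on `D(A*)'` by duality: `⟨S_A(t) f, z⟩ = ⟨f, S_A(t)* z⟩`. -/
def inputFunctional (A : H →ₗ.[ℂ] H) (B : U →L[ℂ] AdjointDomainDual A) (T : ℝ)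
    (u : InputSpace U) (z : GraphDomain A.adjoint) : ℂ :=
  ∫ s in (0 : ℝ)..T, B (u s) (GraphDomain.of A.adjoint
    (ContinuousLinearMap.adjoint (semigroup A (T - s)) (GraphDomain.incl A.adjoint z)))

/-- `B` is an admissible control operator for `A`: for some `T > 0`, the element
`∫_0^T S_A(T-s) B u(s) ds` of `D(A*)'` belongs to `H` for every `u ∈ L²(0, +∞; U)`. -/
def IsAdmissible (A : H →ₗ.[ℂ] H) (B : U →L[ℂ] AdjointDomainDual A) : Prop :=
  ∃ T : ℝ, 0 < T ∧ ∀ u : InputSpace U, ∃ y : H, ∀ z : GraphDomain A.adjoint,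
    inner ℂ (GraphDomain.incl A.adjoint z) y = inputFunctional A B T u z

/-- `Φ ∈ L(L²(0, +∞; U), H)` is the input map of `(A, B)` at time `T`:
`Φ u = ∫_0^T S_A(T-s) B u(s) ds` in `D(A*)'`. -/
def IsInputMap (A : H →ₗ.[ℂ] H) (B : U →L[ℂ] AdjointDomainDual A) (T : ℝ)
    (Φ : InputSpace U →L[ℂ] H) : Prop :=
  ∀ (u : InputSpace U) (z : GraphDomain A.adjoint),
    inner ℂ (GraphDomain.incl A.adjoint z) (Φ u) = inputFunctional A B T u z

open scoped Classical in
/-- The input map `Φ(T)` of `(A, B)` at time `T` (unique, because `D(A*)` is dense in `H`). It is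
only meaningful if `A` generates a `C₀`-semigroup and `B` is admissible for `A`. -/
def inputMap (A : H →ₗ.[ℂ] H) (B : U →L[ℂ] AdjointDomainDual A) (T : ℝ) :
    InputSpace U →L[ℂ] H :=
  if h : ∃ Φ : InputSpace U →L[ℂ] H, IsInputMap A B T Φ then h.choose else 0

/-! ### Bounded perturbations -/

/-- The operator `A + P` with domain `D(A)`, for bounded `P`. -/
def perturb (A : H →ₗ.[ℂ] H) (P : H →L[ℂ] H) : H →ₗ.[ℂ] H := (P : H →ₗ[ℂ] H) +ᵥ A

theorem perturb_adjoint_domain (A : H →ₗ.[ℂ] H) (P : H →L[ℂ] H) :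
    (perturb A P).adjoint.domain = A.adjoint.domain := by
  ext y
  rw [LinearPMap.mem_adjoint_domain_iff, LinearPMap.mem_adjoint_domain_iff]
  have hP : Continuous fun x : A.domain => inner ℂ y (P x) := by fun_prop
  constructor
  · intro h
    have h' : Continuous fun x : A.domain => inner ℂ y (P x + A x) := h
    refine (h'.sub hP).congr fun x => ?_
    change inner ℂ y (P x + A x) - inner ℂ y (P x) = inner ℂ y (A x)
    rw [inner_add_right, add_sub_cancel_left]
  · intro h
    have h' : Continuous fun x : A.domain => inner ℂ y (A x) := h
    refine (hP.add h').congr fun x => ?_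
    exact (inner_add_right y (P x) (A x)).symm

/-- The identity map `D((A + P)*) → D(A*)`, as a linear map. -/
def perturbDomain (A : H →ₗ.[ℂ] H) (P : H →L[ℂ] H) :
    GraphDomain (perturb A P).adjoint →ₗ[ℂ] GraphDomain A.adjoint :=
  Submodule.inclusion (perturb_adjoint_domain A P).le

theorem perturbDomain_op (A : H →ₗ.[ℂ] H) (hA : Dense (A.domain : Set H)) (P : H →L[ℂ] H)
    (z : GraphDomain (perturb A P).adjoint) :
    GraphDomain.op A.adjoint (perturbDomain A P z) = GraphDomain.op (perturb A P).adjoint z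
      - ContinuousLinearMap.adjoint P (GraphDomain.incl _ z) := by
  refine LinearPMap.adjoint_apply_eq hA _ fun x => ?_
  have h2 : inner ℂ (GraphDomain.op (perturb A P).adjoint z) (x : H)
      = inner ℂ (GraphDomain.incl _ z) (P x + A x) :=
    LinearPMap.adjoint_isFormalAdjoint (T := perturb A P) hA z x
  rw [inner_sub_left, h2, inner_add_right, ContinuousLinearMap.adjoint_inner_left,
    add_sub_cancel_left]
  rfl

theorem perturbDomain_continuous (A : H →ₗ.[ℂ] H) (P : H →L[ℂ] H) :
    Continuous (perturbDomain A P) := by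
  have hinc : ∀ z, ‖GraphDomain.incl (perturb A P).adjoint z‖ ≤ ‖z‖ := fun z => by
    rw [GraphDomain.norm_eq]
    exact Real.le_sqrt_of_sq_le (le_add_of_nonneg_right (sq_nonneg _))
  have hop : ∀ z, ‖GraphDomain.op (perturb A P).adjoint z‖ ≤ ‖z‖ := fun z => by
    rw [GraphDomain.norm_eq]
    exact Real.le_sqrt_of_sq_le (le_add_of_nonneg_left (sq_nonneg _))
  have hb : ∀ z, ‖GraphDomain.op A.adjoint (perturbDomain A P z)‖
      ≤ (1 + ‖ContinuousLinearMap.adjoint P‖) * ‖z‖ := by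
    intro z
    by_cases hA : Dense (A.domain : Set H)
    · rw [perturbDomain_op A hA]
      refine (norm_sub_le _ _).trans ?_
      rw [add_mul, one_mul]
      exact add_le_add (hop z) ((ContinuousLinearMap.le_opNorm _ _).trans
        (mul_le_mul_of_nonneg_left (hinc z) (norm_nonneg _)))
    · have h0 : GraphDomain.op A.adjoint (perturbDomain A P z) = 0 :=
        LinearPMap.adjoint_apply_of_not_dense hA _
      rw [h0, norm_zero]
      positivity
  refine AddMonoidHomClass.continuous_of_bound (perturbDomain A P)
    (1 + (1 + ‖ContinuousLinearMap.adjoint P‖)) fun z => ?_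
  rw [GraphDomain.norm_eq]
  have h1 : ‖GraphDomain.incl A.adjoint (perturbDomain A P z)‖ ≤ ‖z‖ := hinc z
  have h2 := hb z
  refine Real.sqrt_le_iff.2 ⟨by positivity, ?_⟩
  nlinarith [norm_nonneg (GraphDomain.incl A.adjoint (perturbDomain A P z)),
    norm_nonneg (GraphDomain.op A.adjoint (perturbDomain A P z)), norm_nonneg z,
    mul_le_mul h1 h1 (norm_nonneg _) (norm_nonneg _),
    mul_le_mul h2 h2 (norm_nonneg _) (by positivity),
    mul_nonneg (norm_nonneg z) (mul_nonneg
      (by positivity : 0 ≤ 1 + ‖ContinuousLinearMap.adjoint P‖) (norm_nonneg z))]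

/-- The control operator `B ∈ L(U, D(A*)')`, seen as an element of `L(U, D((A + P)*)')` through
`D((A + P)*) = D(A*)` (with equivalent graph norms). -/
def perturbControl {A : H →ₗ.[ℂ] H} (B : U →L[ℂ] AdjointDomainDual A) (P : H →L[ℂ] H) :
    U →L[ℂ] AdjointDomainDual (perturb A P) :=
  (ContinuousLinearMap.flip
    (B.flip.comp (⟨perturbDomain A P, perturbDomain_continuous A P⟩ :
      GraphDomain (perturb A P).adjoint →L[ℂ] GraphDomain A.adjoint)))

theorem perturb_apply (A : H →ₗ.[ℂ] H) (P : H →L[ℂ] H) (x : A.domain) :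
    perturb A P x = A x + P x := add_comm (P x) (A x)

/-- The Volterra operator `V y(t) = ∫_0^t S_A(t-s)* P* y(s) ds`. -/
def volterra (A : H →ₗ.[ℂ] H) (P : H →L[ℂ] H) (y : ℝ → H) (t : ℝ) : H :=
  ∫ s in (0 : ℝ)..t, ContinuousLinearMap.adjoint (semigroup A (t - s))
    (ContinuousLinearMap.adjoint P (y s))

/-- The orbit `t ↦ S_A(t)* z₀` of the adjoint semigroup. -/
def adjointOrbit (A : H →ₗ.[ℂ] H) (z₀ : H) (t : ℝ) : H :=
  ContinuousLinearMap.adjoint (semigroup A t) z₀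

end Control

end

end ControlSystem

open ControlSystem

namespace ControlSystem

noncomputable section

/-! ### Semigroups: growth, orbit integrals, the generator -/

section C0Semigroup

variable {H : Type*} [NormedAddCommGroup H] [InnerProductSpace ℂ H] {S : ℝ → H →L[ℂ] H}
  {A : H →ₗ.[ℂ] H}

/-! Everything is done on the adjoint side. For `z ∈ D(A*)` the adjoint of the input map is the
observation `t ↦ B* S_A(t)* z`, run backwards in time and cut off at `T` (`inner_outputMap`,
`IsInputMap.adjoint_apply`). Hence admissibility amounts to an inequality `∫ ‖B* S_A(t)* z‖² ≤ c
‖z‖²` on `D(A*)`: Banach–Steinhaus gives it on one time interval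
(`IsAdmissible.exists_observationBound`), the semigroup law carries it to every interval, and
conversely it yields a bounded input map by density (`ObservationBound.exists_isInputMap`).

Write `y₁`, `y₂` for the orbits of `z` under the two adjoint semigroups. Duhamel's formula
(`duhamel_adjoint`) reads `y₂ = y₁ + V y₂`, so that `w = y₂ - y₁` satisfies `w = V y₁ + V w`. Two
estimates close the argument. Gronwall's inequality bounds `w` in `L²` by `V y₁`
(`integral_norm_sq_sub_adjointPath_le`). The observation inequality makes `y ↦ B* V y` bounded in
`L²` (`integral_observation_volterraPath_le`); this is a Cauchy–Schwarz and Fubini argument, carried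
out after replacing `B*` by bounded operators. Together, `B* w` is bounded in `L²` by `B* V y₁` and
`V y₁`, hence by `‖F z‖`. The difference of the adjoint input maps is thus dominated by the compact
operator `F` on the dense set `D(A*)`, then on `H`, and an operator dominated by a compact one is
compact.

The same bound for `B* V y`, applied to `y₂ = y₁ + V y₂`, shows that admissibility survives the
perturbation. The perturbed semigroup itself comes from solving a Volterra equation by a Neumann
series. -/

theorem IsC0Semigroup.apply_add (hS : IsC0Semigroup S) {s t : ℝ} (hs : 0 ≤ s) (ht : 0 ≤ t)
    (x : H) : S (s + t) x = S s (S t x) := by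
  rw [hS.map_add s t hs ht]; rfl

theorem IsC0Semigroup.commute (hS : IsC0Semigroup S) {s t : ℝ} (hs : 0 ≤ s) (ht : 0 ≤ t)
    (x : H) : S s (S t x) = S t (S s x) := by
  rw [← hS.apply_add hs ht, add_comm, hS.apply_add ht hs]

theorem IsC0Semigroup.apply_zero (hS : IsC0Semigroup S) (x : H) : S 0 x = x := by
  rw [hS.map_zero]; rfl

/-- `D(A)` is invariant under the semigroup, which commutes with `A`. -/
theorem IsC0Semigroup.apply_mem_graph (hS : IsC0Semigroup S) (hA : IsGenerator A S) {t : ℝ}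
    (ht : 0 ≤ t) {x y : H} (hx : (x, y) ∈ A.graph) : (S t x, S t y) ∈ A.graph := by
  rw [hA] at hx ⊢
  refine (((S t).continuous.tendsto y).comp hx).congr' ?_
  filter_upwards [self_mem_nhdsWithin] with s hs
  rw [hS.commute (le_of_lt hs) ht]
  simp

/-- For `s > t` the increment is `(S(s-t) - 1) S(t) x`, and `S(t) x` is again in the domain. Only
the right derivative comes directly from the generator. The clamp `max t 0` makes orbits continuous
on the whole line, which spares side conditions throughout. -/
theorem IsC0Semigroup.hasDerivWithinAt_orbit (hS : IsC0Semigroup S) (hA : IsGenerator A S)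
    {x y : H} (hx : (x, y) ∈ A.graph) {t : ℝ} (ht : 0 ≤ t) :
    HasDerivWithinAt (fun t => S (max t 0) x) (S t y) (Ioi t) t := by
  rw [hasDerivWithinAt_iff_tendsto_slope' self_notMem_Ioi]
  have h1 := (hA _ _).1 (hS.apply_mem_graph hA ht hx)
  have h2 : Tendsto (fun s : ℝ => s - t) (𝓝[>] t) (𝓝[>] 0) := by
    refine tendsto_nhdsWithin_of_tendsto_nhds_of_eventually_within _ ?_ ?_
    · have : Tendsto (fun s : ℝ => s - t) (𝓝 t) (𝓝 (t - t)) := by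
        exact (continuous_id.sub continuous_const).tendsto t
      rw [sub_self] at this
      exact this.mono_left nhdsWithin_le_nhds
    · filter_upwards [self_mem_nhdsWithin] with s hs using sub_pos.2 (mem_Ioi.1 hs)
  refine (h1.comp h2).congr' ?_
  filter_upwards [self_mem_nhdsWithin] with s hs
  have hs' : t < s := hs
  simp only [Function.comp_apply, slope, vsub_eq_sub]
  rw [max_eq_left ht, max_eq_left (ht.trans hs'.le), ← hS.apply_add (by linarith) ht,
    sub_add_cancel]
  exact Complex.coe_smul _ _

variable [CompleteSpace H]

/-- A `C₀`-semigroup is bounded on bounded time intervals. -/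
theorem IsC0Semigroup.exists_bound (hS : IsC0Semigroup S) (T : ℝ) :
    ∃ M : ℝ, 0 ≤ M ∧ ∀ t ∈ Icc 0 T, ‖S t‖ ≤ M := by
  have h : ∀ x, ∃ C, ∀ i : Icc (0 : ℝ) T, ‖S i x‖ ≤ C := fun x => by
    obtain ⟨C, hC⟩ := isCompact_Icc.exists_bound_of_continuousOn
      ((hS.continuousOn x).mono (Icc_subset_Ici_self : Icc 0 T ⊆ Ici 0))
    exact ⟨C, fun i => hC i i.2⟩
  obtain ⟨M, hM⟩ := banach_steinhaus h
  exact ⟨max M 0, le_max_right _ _, fun t ht => (hM ⟨t, ht⟩).trans (le_max_left _ _)⟩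

/-- Exponential growth bound of a `C₀`-semigroup. -/
theorem IsC0Semigroup.exists_growth_bound (hS : IsC0Semigroup S) :
    ∃ M ω : ℝ, 0 ≤ M ∧ 0 ≤ ω ∧ ∀ t, 0 ≤ t → ‖S t‖ ≤ M * Real.exp (ω * t) := by
  obtain ⟨M₀, -, hM₀⟩ := hS.exists_bound 1
  set M := max M₀ 1
  have hM : ∀ t ∈ Icc (0 : ℝ) 1, ‖S t‖ ≤ M := fun t ht => (hM₀ t ht).trans (le_max_left _ _)
  have hM1 : 1 ≤ M := le_max_right _ _
  have key : ∀ n : ℕ, ∀ t : ℝ, 0 ≤ t → t ≤ n + 1 → ‖S t‖ ≤ M * M ^ n := by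
    intro n
    induction n with
    | zero => intro t h0 h1; simpa using hM t ⟨h0, by simpa using h1⟩
    | succ n ih =>
      intro t h0 h1
      rcases le_total t 1 with h | h
      · refine (hM t ⟨h0, h⟩).trans ?_
        exact le_mul_of_one_le_right (by positivity) (one_le_pow₀ hM1)
      · have e : S t = S 1 * S (t - 1) := by
          rw [← hS.map_add 1 (t - 1) zero_le_one (by linarith)]; congr 1; ring
        rw [e]
        refine (norm_mul_le _ _).trans ?_
        have h2 := ih (t - 1) (by linarith) (by push_cast at h1; linarith)
        calc ‖S 1‖ * ‖S (t - 1)‖ ≤ M * (M * M ^ n) :=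
              mul_le_mul (hM 1 (by simp)) h2 (norm_nonneg _) (by positivity)
          _ = M * M ^ (n + 1) := by ring
  -- Steps of length one cost a factor `M` each, and `M ^ ⌊t⌋ ≤ exp (t log M)`; enlarging `M` to at
  -- least `1` keeps the rate nonnegative.
  refine ⟨M, Real.log M, by positivity, Real.log_nonneg hM1, fun t ht => ?_⟩
  refine (key ⌊t⌋₊ t ht (Nat.lt_floor_add_one t).le).trans ?_
  refine mul_le_mul_of_nonneg_left ?_ (by positivity)
  rw [← Real.rpow_def_of_pos (by positivity), ← Real.rpow_natCast]
  exact Real.rpow_le_rpow_of_exponent_le hM1 (Nat.floor_le ht)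

/-- Joint continuity of `(t, x) ↦ S(t) x`. -/
theorem IsC0Semigroup.continuous_uncurry (hS : IsC0Semigroup S) :
    Continuous fun p : ℝ × H => S (max p.1 0) p.2 := by
  rw [continuous_iff_continuousAt]
  rintro ⟨t₀, x₀⟩
  obtain ⟨M, hM0, hM⟩ := hS.exists_bound (|t₀| + 1)
  have horb : Continuous fun t : ℝ => S (max t 0) x₀ :=
    (hS.continuousOn x₀).comp_continuous (by fun_prop) fun t => mem_Ici.2 (le_max_right _ _)
  rw [ContinuousAt, tendsto_iff_norm_sub_tendsto_zero]
  have hlim : Tendsto (fun p : ℝ × H => M * ‖p.2 - x₀‖ + ‖S (max p.1 0) x₀ - S (max t₀ 0) x₀‖)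
      (𝓝 (t₀, x₀)) (𝓝 0) := by
    have hc : Continuous fun p : ℝ × H =>
        M * ‖p.2 - x₀‖ + ‖S (max p.1 0) x₀ - S (max t₀ 0) x₀‖ := by
      exact (continuous_const.mul (continuous_snd.sub continuous_const).norm).add
        ((horb.comp continuous_fst).sub continuous_const).norm
    simpa using hc.tendsto (t₀, x₀)
  refine squeeze_zero' (Eventually.of_forall fun _ => norm_nonneg _) ?_ hlim
  have hev : ∀ᶠ p : ℝ × H in 𝓝 (t₀, x₀), p.1 ≤ |t₀| + 1 :=
    continuous_fst.continuousAt.eventually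
      (eventually_le_nhds (lt_of_le_of_lt (le_abs_self t₀) (lt_add_one _)))
  filter_upwards [hev] with p hp
  have e : S (max p.1 0) p.2 - S (max t₀ 0) x₀
      = S (max p.1 0) (p.2 - x₀) + (S (max p.1 0) x₀ - S (max t₀ 0) x₀) := by
    rw [map_sub]; abel
  rw [e]
  refine (norm_add_le _ _).trans (add_le_add ?_ le_rfl)
  refine (ContinuousLinearMap.le_opNorm _ _).trans ?_
  exact mul_le_mul_of_nonneg_right
    (hM _ ⟨le_max_right _ _, max_le hp (by positivity)⟩) (norm_nonneg _)

theorem IsC0Semigroup.continuous_apply (hS : IsC0Semigroup S) {X : Type*} [TopologicalSpace X]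
    {f : X → ℝ} {g : X → H} (hf : Continuous f) (hg : Continuous g) :
    Continuous fun a => S (max (f a) 0) (g a) :=
  hS.continuous_uncurry.comp (hf.prodMk hg)

theorem IsC0Semigroup.continuous_orbit (hS : IsC0Semigroup S) (x : H) :
    Continuous fun t : ℝ => S (max t 0) x :=
  hS.continuous_apply continuous_id continuous_const

/-- The bounded operator `x ↦ ∫_0^h S(r) x dr`. -/
def IsC0Semigroup.orbitIntegral (hS : IsC0Semigroup S) (h : ℝ) : H →L[ℂ] H :=
  LinearMap.mkContinuousOfExistsBound
    { toFun := fun x => ∫ r in (0 : ℝ)..h, S (max r 0) x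
      map_add' := fun x y => by
        simp only [_root_.map_add]
        exact intervalIntegral.integral_add ((hS.continuous_orbit x).intervalIntegrable _ _)
          ((hS.continuous_orbit y).intervalIntegrable _ _)
      map_smul' := fun c x => by
        simp only [map_smul, RingHom.id_apply]
        exact intervalIntegral.integral_smul c _ }
    (by
      obtain ⟨M, hM0, hM⟩ := hS.exists_bound |h|
      refine ⟨M * |h|, fun x => ?_⟩
      have : ∀ r ∈ uIoc 0 h, ‖S (max r 0) x‖ ≤ M * ‖x‖ := fun r hr => by
        refine (ContinuousLinearMap.le_opNorm _ _).trans
          (mul_le_mul_of_nonneg_right (hM _ ⟨le_max_right _ _, max_le ?_ (abs_nonneg _)⟩)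
            (norm_nonneg _))
        rcases le_total 0 h with h0 | h0
        · rw [uIoc_of_le h0] at hr; exact hr.2.trans (le_abs_self h)
        · rw [uIoc_of_ge h0] at hr; exact hr.2.trans (abs_nonneg _)
      have h2 := intervalIntegral.norm_integral_le_of_norm_le_const this
      rw [sub_zero] at h2
      calc _ ≤ M * ‖x‖ * |h| := h2
        _ = _ := by ring)

theorem IsC0Semigroup.orbitIntegral_apply (hS : IsC0Semigroup S) (h : ℝ) (x : H) :
    hS.orbitIntegral h x = ∫ r in (0 : ℝ)..h, S (max r 0) x := rfl

theorem IsC0Semigroup.norm_orbitIntegral_le (hS : IsC0Semigroup S) {h M : ℝ} (h0 : 0 ≤ h)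
    (hM : ∀ t ∈ Icc 0 h, ‖S t‖ ≤ M) : ‖hS.orbitIntegral h‖ ≤ h * M := by
  have hM0 : 0 ≤ M := (norm_nonneg _).trans (hM 0 ⟨le_rfl, h0⟩)
  refine ContinuousLinearMap.opNorm_le_bound _ (by positivity) fun x => ?_
  have : ∀ r ∈ uIoc 0 h, ‖S (max r 0) x‖ ≤ M * ‖x‖ := fun r hr => by
    rw [uIoc_of_le h0] at hr
    exact (ContinuousLinearMap.le_opNorm _ _).trans
      (mul_le_mul_of_nonneg_right (hM _ ⟨le_max_right _ _, max_le hr.2 h0⟩) (norm_nonneg _))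
  have h2 := intervalIntegral.norm_integral_le_of_norm_le_const this
  rw [sub_zero, abs_of_nonneg h0] at h2
  rw [hS.orbitIntegral_apply]
  linarith

/-- The mean `(1/h) ∫_0^h g` of a continuous function tends to `g 0`. -/
theorem tendsto_inv_smul_integral {E : Type*} [NormedAddCommGroup E] [NormedSpace ℂ E]
    [CompleteSpace E] {g : ℝ → E} (hg : Continuous g) (a : ℝ) :
    Tendsto (fun h : ℝ => ((h⁻¹ : ℝ) : ℂ) • ∫ r in a..(a + h), g r) (𝓝[>] 0) (𝓝 (g a)) := by
  have hd : HasDerivAt (fun u => ∫ r in a..u, g r) (g a) a :=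
    intervalIntegral.integral_hasDerivAt_right (hg.intervalIntegrable _ _)
      hg.stronglyMeasurable.stronglyMeasurableAtFilter hg.continuousAt
  have := hd.tendsto_slope_zero_right
  simp only [intervalIntegral.integral_same, sub_zero] at this
  exact this.congr fun h => (Complex.coe_smul _ _).symm

theorem IsC0Semigroup.tendsto_orbitIntegral (hS : IsC0Semigroup S) (x : H) :
    Tendsto (fun h : ℝ => ((h⁻¹ : ℝ) : ℂ) • hS.orbitIntegral h x) (𝓝[>] 0) (𝓝 x) := by
  simpa [hS.apply_zero, hS.orbitIntegral_apply] using
    tendsto_inv_smul_integral (hS.continuous_orbit x) 0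

theorem IsC0Semigroup.apply_orbitIntegral (hS : IsC0Semigroup S) {k : ℝ} (hk : 0 ≤ k) {h : ℝ}
    (hh : 0 ≤ h) (x : H) :
    S k (hS.orbitIntegral h x) = ∫ r in k..(k + h), S (max r 0) x := by
  have h1 : S k (hS.orbitIntegral h x) = ∫ r in (0 : ℝ)..h, S k (S (max r 0) x) :=
    ((S k).intervalIntegral_comp_comm ((hS.continuous_orbit x).intervalIntegrable _ _)).symm
  have h2 : ∫ r in (0 : ℝ)..h, S k (S (max r 0) x)
      = ∫ r in (0 : ℝ)..h, S (max (k + r) 0) x := by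
    refine intervalIntegral.integral_congr fun r hr => ?_
    rw [uIcc_of_le hh] at hr
    rw [max_eq_left hr.1, max_eq_left (add_nonneg hk hr.1), hS.apply_add hk hr.1]
  rw [h1, h2, intervalIntegral.integral_comp_add_left (fun r => S (max r 0) x), add_zero]

/-- Applying `S(k)` shifts the window of integration, so `(S(k) - 1) ∫_0^h` is `∫_h^{h+k} - ∫_0^k`.
Dividing by `k` leaves two means of a continuous function. -/
theorem IsC0Semigroup.orbitIntegral_mem_graph (hS : IsC0Semigroup S) (hA : IsGenerator A S)
    {h : ℝ} (hh : 0 ≤ h) (x : H) : (hS.orbitIntegral h x, S h x - x) ∈ A.graph := by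
  rw [hA]
  have hc := hS.continuous_orbit x
  have h1 := (tendsto_inv_smul_integral hc h).sub (tendsto_inv_smul_integral hc 0)
  simp only [max_eq_left hh, max_self, hS.apply_zero] at h1
  refine h1.congr' ?_
  filter_upwards [self_mem_nhdsWithin] with k hk
  have hk' : (0 : ℝ) ≤ k := le_of_lt hk
  rw [← smul_sub, hS.apply_orbitIntegral hk' hh, hS.orbitIntegral_apply]
  congr 1
  have i : ∀ a b : ℝ, IntervalIntegrable (fun r => S (max r 0) x) volume a b :=
    fun a b => hc.intervalIntegrable a b
  rw [← intervalIntegral.integral_add_adjacent_intervals (i 0 k) (i k h),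
    ← intervalIntegral.integral_add_adjacent_intervals (i k h) (i h (k + h)), add_comm h k,
    zero_add]
  abel

theorem IsC0Semigroup.orbitIntegral_apply_generator (hS : IsC0Semigroup S) (hA : IsGenerator A S)
    {x y : H} (hx : (x, y) ∈ A.graph) {h : ℝ} (hh : 0 ≤ h) :
    hS.orbitIntegral h y = S h x - x := by
  have := intervalIntegral.integral_eq_sub_of_hasDeriv_right_of_le (f := fun t => S (max t 0) x)
    (f' := fun t => S (max t 0) y) hh (hS.continuous_orbit x).continuousOn
    (fun t ht => by
      have := hS.hasDerivWithinAt_orbit hA hx ht.1.le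
      simpa [max_eq_left ht.1.le] using this)
    ((hS.continuous_orbit y).intervalIntegrable _ _)
  rw [hS.orbitIntegral_apply, this, max_eq_left hh, max_self, hS.apply_zero]

/-- The right derivative already gives `S(t) x = x + ∫_0^t S(r) y dr`, and the integral of a
continuous function is differentiable from both sides. -/
theorem IsC0Semigroup.hasDerivAt_orbit (hS : IsC0Semigroup S) (hA : IsGenerator A S)
    {x y : H} (hx : (x, y) ∈ A.graph) {t : ℝ} (ht : 0 < t) :
    HasDerivAt (fun t => S (max t 0) x) (S t y) t := by
  have hg := hS.continuous_orbit y
  have hd : HasDerivAt (fun u => ∫ r in (0 : ℝ)..u, S (max r 0) y) (S (max t 0) y) t :=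
    intervalIntegral.integral_hasDerivAt_right (hg.intervalIntegrable _ _)
      hg.stronglyMeasurable.stronglyMeasurableAtFilter hg.continuousAt
  rw [max_eq_left ht.le] at hd
  refine (hd.add_const x).congr_of_eventuallyEq ?_
  filter_upwards [eventually_gt_nhds ht] with s hs
  change S (max s 0) x = hS.orbitIntegral s y + x
  rw [hS.orbitIntegral_apply_generator hA hx hs.le, max_eq_left hs.le, sub_add_cancel]

/-- The means of the orbit of `x` lie in the domain and tend to `x`. -/
theorem IsC0Semigroup.dense_domain (hS : IsC0Semigroup S) (hA : IsGenerator A S) :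
    Dense (A.domain : Set H) := by
  intro x
  refine mem_closure_of_tendsto (hS.tendsto_orbitIntegral x) ?_
  filter_upwards [self_mem_nhdsWithin] with h hh
  exact A.domain.smul_mem _
    (LinearPMap.mem_domain_of_mem_graph (hS.orbitIntegral_mem_graph hA (le_of_lt hh) x))

end C0Semigroup

/-! ### The adjoint semigroup and its generator -/

section AdjointSemigroup

variable {H : Type*} [NormedAddCommGroup H] [InnerProductSpace ℂ H] [CompleteSpace H]
  {S : ℝ → H →L[ℂ] H} {A : H →ₗ.[ℂ] H}

/-- The adjoint semigroup `t ↦ S(t)*`. -/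
def adjointSemigroup (S : ℝ → H →L[ℂ] H) (t : ℝ) : H →L[ℂ] H :=
  ContinuousLinearMap.adjoint (S t)

theorem inner_adjointSemigroup (t : ℝ) (z x : H) :
    inner ℂ (adjointSemigroup S t z) x = inner ℂ z (S t x) :=
  ContinuousLinearMap.adjoint_inner_left _ _ _

theorem norm_adjointSemigroup (t : ℝ) : ‖adjointSemigroup S t‖ = ‖S t‖ :=
  LinearIsometryEquiv.norm_map _ _

/-- The graph of the adjoint of a densely defined operator. -/
theorem mem_graph_adjoint_iff (hA : Dense (A.domain : Set H)) {z w : H} :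
    (z, w) ∈ A.adjoint.graph ↔ ∀ x y : H, (x, y) ∈ A.graph → inner ℂ w x = inner ℂ z y := by
  rw [LinearPMap.adjoint_graph_eq_graph_adjoint hA, Submodule.mem_adjoint_iff]
  simp only [sub_eq_zero]
  constructor
  · intro h x y hxy
    have := h x y hxy
    rw [← inner_conj_symm w x, ← inner_conj_symm z y]
    exact congrArg _ this.symm
  · intro h x y hxy
    rw [← inner_conj_symm x w, ← inner_conj_symm y z]
    exact congrArg _ (h x y hxy).symm

theorem IsC0Semigroup.adjoint_orbitIntegral_mem_graph (hS : IsC0Semigroup S)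
    (hA : IsGenerator A S) {h : ℝ} (hh : 0 ≤ h) (z : H) :
    (ContinuousLinearMap.adjoint (hS.orbitIntegral h) z, adjointSemigroup S h z - z)
      ∈ A.adjoint.graph := by
  rw [mem_graph_adjoint_iff (hS.dense_domain hA)]
  intro x y hxy
  rw [ContinuousLinearMap.adjoint_inner_left, hS.orbitIntegral_apply_generator hA hxy hh,
    inner_sub_left, inner_sub_right, inner_adjointSemigroup]

/-- The adjoint of the generator of a `C₀`-semigroup is densely defined. -/
theorem IsC0Semigroup.dense_adjoint_domain (hS : IsC0Semigroup S) (hA : IsGenerator A S) :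
    Dense (A.adjoint.domain : Set H) := by
  rw [Submodule.dense_iff_topologicalClosure_eq_top,
    Submodule.topologicalClosure_eq_top_iff, Submodule.eq_bot_iff]
  intro y hy
  -- A vector orthogonal to `D(A*)` is killed by every orbit integral, because the adjoints of these
  -- integrals map into `D(A*)`. Its orbit means are then zero, and they converge to the vector.
  have h0 : ∀ h : ℝ, 0 ≤ h → hS.orbitIntegral h y = 0 := fun h hh => by
    refine ext_inner_left ℂ fun z => ?_
    rw [inner_zero_right, ← ContinuousLinearMap.adjoint_inner_left]
    exact (Submodule.mem_orthogonal _ _).1 hy _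
      (LinearPMap.mem_domain_of_mem_graph (hS.adjoint_orbitIntegral_mem_graph hA hh z))
  refine tendsto_nhds_unique (hS.tendsto_orbitIntegral y) (tendsto_const_nhds.congr' ?_)
  filter_upwards [self_mem_nhdsWithin] with h hh
  rw [h0 h (le_of_lt hh), smul_zero]

theorem IsC0Semigroup.adjoint_orbitIntegral_apply (hS : IsC0Semigroup S) (hA : IsGenerator A S)
    {z w : H} (hz : (z, w) ∈ A.adjoint.graph) {h : ℝ} (hh : 0 ≤ h) :
    ContinuousLinearMap.adjoint (hS.orbitIntegral h) w = adjointSemigroup S h z - z := by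
  refine ext_inner_right ℂ fun x => ?_
  rw [ContinuousLinearMap.adjoint_inner_left, inner_sub_left, inner_adjointSemigroup,
    ← inner_sub_right]
  exact (mem_graph_adjoint_iff (hS.dense_domain hA)).1 hz _ _ (hS.orbitIntegral_mem_graph hA hh x)

theorem adjointSemigroup_add (hS : IsC0Semigroup S) {s t : ℝ} (hs : 0 ≤ s) (ht : 0 ≤ t) :
    adjointSemigroup S (s + t) = adjointSemigroup S s * adjointSemigroup S t := by
  rw [adjointSemigroup, add_comm, hS.map_add t s ht hs]
  exact ContinuousLinearMap.adjoint_comp _ _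

/-- The adjoint of a `C₀`-semigroup on a Hilbert space is a `C₀`-semigroup. -/
theorem IsC0Semigroup.adjoint (hS : IsC0Semigroup S) (hA : IsGenerator A S) :
    IsC0Semigroup (adjointSemigroup S) where
  map_zero := by
    refine ContinuousLinearMap.ext fun z => ext_inner_right ℂ fun x => ?_
    rw [inner_adjointSemigroup, hS.apply_zero]; rfl
  map_add := fun s t hs ht => adjointSemigroup_add hS hs ht
  continuousOn := by
    -- On `D(A*)` adjoint orbits are locally Lipschitz: the increment from `s` to `t` is `S(s)*`
    -- applied to the adjoint of the orbit integral over `[0, t-s]`, evaluated at `w = A* z`.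
    have key : ∀ z ∈ A.adjoint.domain, ∀ T,
        ContinuousOn (fun t => adjointSemigroup S t z) (Icc 0 T) := by
      intro z hz T
      obtain ⟨w, hw⟩ := LinearPMap.mem_domain_iff.1 hz
      obtain ⟨M, hM0, hM⟩ := hS.exists_bound T
      have hle : ∀ s ∈ Icc 0 T, ∀ t ∈ Icc 0 T, s ≤ t →
          ‖adjointSemigroup S t z - adjointSemigroup S s z‖ ≤ (M * M * ‖w‖) * |t - s| := by
        intro s hs t ht hst
        have hd : t - s ∈ Icc 0 T := ⟨by linarith, by linarith [hs.1, ht.2]⟩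
        have e : adjointSemigroup S t z - adjointSemigroup S s z
            = adjointSemigroup S s (ContinuousLinearMap.adjoint (hS.orbitIntegral (t - s)) w) := by
          rw [hS.adjoint_orbitIntegral_apply hA hw hd.1, map_sub]
          have := adjointSemigroup_add hS hs.1 hd.1
          rw [add_sub_cancel] at this
          rw [this]; rfl
        have hI : ‖ContinuousLinearMap.adjoint (hS.orbitIntegral (t - s))‖ ≤ (t - s) * M := by
          rw [LinearIsometryEquiv.norm_map]
          exact hS.norm_orbitIntegral_le hd.1 fun r hr => hM r ⟨hr.1, hr.2.trans hd.2⟩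
        have hs' : ‖adjointSemigroup S s‖ ≤ M := (norm_adjointSemigroup s).le.trans (hM s hs)
        rw [e, abs_of_nonneg hd.1]
        refine (ContinuousLinearMap.le_opNorm _ _).trans ?_
        calc _ ≤ M * (((t - s) * M) * ‖w‖) := by
              refine mul_le_mul hs' ?_ (norm_nonneg _) hM0
              exact (ContinuousLinearMap.le_opNorm _ _).trans
                (mul_le_mul_of_nonneg_right hI (norm_nonneg _))
          _ = _ := by ring
      have hlip : LipschitzOnWith (Real.toNNReal (M * M * ‖w‖))
          (fun t => adjointSemigroup S t z) (Icc 0 T) := by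
        refine LipschitzOnWith.of_dist_le_mul fun t ht s hs => ?_
        rw [Real.coe_toNNReal _ (by positivity), dist_eq_norm, Real.dist_eq]
        rcases le_total s t with h | h
        · exact hle s hs t ht h
        · rw [norm_sub_rev, abs_sub_comm]; exact hle t ht s hs h
      exact hlip.continuousOn
    -- Density of `D(A*)` and the uniform bound on `[0, T]` exhibit every orbit as a uniform limit
    -- of continuous ones.
    have key2 : ∀ z T, ContinuousOn (fun t => adjointSemigroup S t z) (Icc 0 T) := by
      intro z T
      obtain ⟨M, hM0, hM⟩ := hS.exists_bound T
      refine continuousOn_of_uniform_approx_of_continuousOn fun u hu => ?_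
      obtain ⟨ε, hε, hεu⟩ := Metric.mem_uniformity_dist.1 hu
      obtain ⟨z', hz', hd⟩ := Metric.dense_iff.1 (hS.dense_adjoint_domain hA) z (ε / (M + 1))
        (by positivity)
      refine ⟨_, key z' hd T, fun t ht => hεu ?_⟩
      rw [dist_eq_norm, ← map_sub]
      have h1 : ‖z - z'‖ < ε / (M + 1) := by rw [← dist_eq_norm, dist_comm]; exact hz'
      calc _ ≤ M * ‖z - z'‖ := (ContinuousLinearMap.le_opNorm _ _).trans
            (mul_le_mul_of_nonneg_right ((norm_adjointSemigroup t).le.trans (hM t ht))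
              (norm_nonneg _))
        _ ≤ (M + 1) * ‖z - z'‖ := by nlinarith [norm_nonneg (z - z')]
        _ < (M + 1) * (ε / (M + 1)) := mul_lt_mul_of_pos_left h1 (by positivity)
        _ = ε := by field_simp
    intro z t ht
    have h1 : Icc 0 (t + 1) ∈ 𝓝[Ici 0] t := by
      have : Iic (t + 1) ∈ 𝓝 t := Iic_mem_nhds (lt_add_one t)
      exact mem_nhdsWithin_iff_exists_mem_nhds_inter.2 ⟨_, this, fun s hs => ⟨hs.2, hs.1⟩⟩
    exact (key2 z (t + 1) t ⟨ht, (lt_add_one t).le⟩).mono_of_mem_nhdsWithin h1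

/-- Both sides have the same pairings. This makes the convergence of orbit means available for the
adjoint of the integral. -/
theorem IsC0Semigroup.orbitIntegral_adjoint (hS : IsC0Semigroup S) (hA : IsGenerator A S) {h : ℝ}
    (z : H) :
    (hS.adjoint hA).orbitIntegral h z = ContinuousLinearMap.adjoint (hS.orbitIntegral h) z := by
  refine ext_inner_left ℂ fun x => ?_
  rw [ContinuousLinearMap.adjoint_inner_right, ← inner_conj_symm (hS.orbitIntegral h x) z]
  have h1 : inner ℂ z (hS.orbitIntegral h x) = ∫ r in (0 : ℝ)..h, inner ℂ z (S (max r 0) x) :=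
    ((innerSL ℂ z).intervalIntegral_comp_comm
      ((hS.continuous_orbit x).intervalIntegrable _ _)).symm
  have h2 : inner ℂ x ((hS.adjoint hA).orbitIntegral h z)
      = ∫ r in (0 : ℝ)..h, inner ℂ x (adjointSemigroup S (max r 0) z) :=
    ((innerSL ℂ x).intervalIntegral_comp_comm
      (((hS.adjoint hA).continuous_orbit z).intervalIntegrable _ _)).symm
  rw [h1, h2, ← intervalIntegral.intervalIntegral_conj]
  refine intervalIntegral.integral_congr fun r _ => ?_
  rw [inner_conj_symm, adjointSemigroup, ContinuousLinearMap.adjoint_inner_right]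

/-- The adjoint semigroup is generated by the adjoint of the generator. -/
theorem IsGenerator.adjoint (hA : IsGenerator A S) (hS : IsC0Semigroup S) :
    IsGenerator A.adjoint (adjointSemigroup S) := by
  intro z w
  constructor
  · intro hz
    -- The difference quotient of the adjoint orbit of `z` is exactly the mean of the orbit of `w`.
    refine ((hS.adjoint hA).tendsto_orbitIntegral w).congr' ?_
    filter_upwards [self_mem_nhdsWithin] with h hh
    rw [hS.orbitIntegral_adjoint hA, hS.adjoint_orbitIntegral_apply hA hz (le_of_lt hh)]
  · intro hz
    rw [mem_graph_adjoint_iff (hS.dense_domain hA)]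
    intro x y hxy
    have h1 := hz.inner (𝕜 := ℂ) (tendsto_const_nhds (x := x))
    have h2 := (tendsto_const_nhds (x := z)).inner (𝕜 := ℂ) ((hA x y).1 hxy)
    refine tendsto_nhds_unique h1 (h2.congr fun h => ?_)
    rw [inner_smul_left, inner_smul_right, inner_sub_left, inner_sub_right,
      inner_adjointSemigroup, Complex.conj_ofReal]

end AdjointSemigroup

/-! ### Gronwall's inequality, convolutions and Volterra equations -/

section BoundedPerturbation

/-- Gronwall's inequality in integral form. -/
theorem gronwall_integral {a φ : ℝ → ℝ} (ha : Continuous a) (hφ : Continuous φ) {C T : ℝ}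
    (hC : 0 ≤ C) (ha0 : ∀ t ∈ Icc 0 T, 0 ≤ a t)
    (h : ∀ t ∈ Icc 0 T, φ t ≤ a t + C * ∫ s in (0 : ℝ)..t, φ s) {t : ℝ} (ht : t ∈ Icc 0 T) :
    φ t ≤ a t + C * (Real.exp (C * T) * ∫ s in (0 : ℝ)..T, a s) := by
  have hT : 0 ≤ T := ht.1.trans ht.2
  -- By hypothesis `g' = e^{-Ct} (φ - C ∫_0^t φ) - a ≤ (e^{-Ct} - 1) a ≤ 0` on `[0, T]`, so `g ≤ g 0
  -- = 0`, which bounds `∫_0^t φ`.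
  set g : ℝ → ℝ := fun t => Real.exp (-(C * t)) * (∫ s in (0 : ℝ)..t, φ s) - ∫ s in (0 : ℝ)..t, a s
  have hd : ∀ t, HasDerivAt g (Real.exp (-(C * t)) * -C * (∫ s in (0 : ℝ)..t, φ s)
      + Real.exp (-(C * t)) * φ t - a t) t := fun t => by
    have h1 : HasDerivAt (fun t => Real.exp (-(C * t))) (Real.exp (-(C * t)) * -C) t := by
      simpa using ((hasDerivAt_id t).const_mul C).neg.exp
    have h2 : HasDerivAt (fun t => ∫ s in (0 : ℝ)..t, φ s) (φ t) t :=
      intervalIntegral.integral_hasDerivAt_right (hφ.intervalIntegrable _ _)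
        hφ.stronglyMeasurable.stronglyMeasurableAtFilter hφ.continuousAt
    have h3 : HasDerivAt (fun t => ∫ s in (0 : ℝ)..t, a s) (a t) t :=
      intervalIntegral.integral_hasDerivAt_right (ha.intervalIntegrable _ _)
        ha.stronglyMeasurable.stronglyMeasurableAtFilter ha.continuousAt
    exact (h1.mul h2).sub h3
  have hanti : AntitoneOn g (Icc 0 T) := by
    refine antitoneOn_of_deriv_nonpos (convex_Icc 0 T)
      (fun t _ => (hd t).continuousAt.continuousWithinAt)
      (fun t _ => (hd t).differentiableAt.differentiableWithinAt) fun t ht => ?_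
    have ht' : t ∈ Icc 0 T := interior_subset ht
    rw [(hd t).deriv]
    have e0 := Real.exp_pos (-(C * t))
    have e1 : Real.exp (-(C * t)) ≤ 1 := by
      rw [Real.exp_le_one_iff]; have := mul_nonneg hC ht'.1; linarith
    have h1 := h t ht'
    have h2 := ha0 t ht'
    nlinarith
  have h1 : g t ≤ g 0 := hanti ⟨le_rfl, hT⟩ ht ht.1
  simp only [g, intervalIntegral.integral_same, mul_zero, sub_zero, sub_nonpos] at h1
  have hint : ∫ s in (0 : ℝ)..t, a s ≤ ∫ s in (0 : ℝ)..T, a s := by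
    rw [← intervalIntegral.integral_add_adjacent_intervals (ha.intervalIntegrable 0 t)
      (ha.intervalIntegrable t T)]
    have := intervalIntegral.integral_nonneg ht.2
      (fun s hs => ha0 s ⟨ht.1.trans hs.1, hs.2⟩) (μ := volume)
    linarith
  have hint0 : 0 ≤ ∫ s in (0 : ℝ)..T, a s := intervalIntegral.integral_nonneg hT ha0
  have h2 : ∫ s in (0 : ℝ)..t, φ s ≤ Real.exp (C * T) * ∫ s in (0 : ℝ)..T, a s := by
    calc ∫ s in (0 : ℝ)..t, φ s
        = Real.exp (C * t) * (Real.exp (-(C * t)) * ∫ s in (0 : ℝ)..t, φ s) := by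
          rw [← mul_assoc, ← Real.exp_add, add_neg_cancel, Real.exp_zero, one_mul]
      _ ≤ Real.exp (C * t) * ∫ s in (0 : ℝ)..T, a s :=
          mul_le_mul_of_nonneg_left (h1.trans hint) (Real.exp_pos _).le
      _ ≤ _ := mul_le_mul_of_nonneg_right
          (Real.exp_le_exp.2 (mul_le_mul_of_nonneg_left ht.2 hC)) hint0
  exact (h t ht).trans (add_le_add le_rfl (mul_le_mul_of_nonneg_left h2 hC))

variable {H : Type*} [NormedAddCommGroup H] [InnerProductSpace ℂ H]
  {S : ℝ → H →L[ℂ] H} {A : H →ₗ.[ℂ] H}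

/-- The convolution `∫_0^t S(t-s) f(s) ds`, for `t ≥ 0`. -/
def convolution (S : ℝ → H →L[ℂ] H) (f : ℝ → H) (t : ℝ) : H :=
  ∫ s in (0 : ℝ)..t, S (max (t - s) 0) (f s)

variable [CompleteSpace H]

theorem IsC0Semigroup.continuous_convolution_integrand (hS : IsC0Semigroup S) {f : ℝ → H}
    (hf : Continuous f) : Continuous fun p : ℝ × ℝ => S (max (p.1 - p.2) 0) (f p.2) :=
  hS.continuous_apply (continuous_fst.sub continuous_snd) (hf.comp continuous_snd)

theorem IsC0Semigroup.continuous_convolution_integrand_right (hS : IsC0Semigroup S) {f : ℝ → H}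
    (hf : Continuous f) (t : ℝ) : Continuous fun s => S (max (t - s) 0) (f s) :=
  (hS.continuous_convolution_integrand hf).comp (Continuous.prodMk_right t)

theorem IsC0Semigroup.continuous_convolution (hS : IsC0Semigroup S) {f : ℝ → H}
    (hf : Continuous f) : Continuous (convolution S f) :=
  intervalIntegral.continuous_parametric_intervalIntegral_of_continuous
    (hS.continuous_convolution_integrand hf) continuous_id

theorem IsC0Semigroup.convolution_sub (hS : IsC0Semigroup S) {f g : ℝ → H}
    (hf : Continuous f) (hg : Continuous g) (t : ℝ) :
    convolution S (fun s => f s - g s) t = convolution S f t - convolution S g t := by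
  simp only [convolution, map_sub]
  exact intervalIntegral.integral_sub
    ((hS.continuous_convolution_integrand_right hf t).intervalIntegrable _ _)
    ((hS.continuous_convolution_integrand_right hg t).intervalIntegrable _ _)

theorem IsC0Semigroup.norm_convolution_le (hS : IsC0Semigroup S) {f : ℝ → H}
    (hf : Continuous f) {T M : ℝ} (hM : ∀ t ∈ Icc 0 T, ‖S t‖ ≤ M) {t : ℝ} (ht : t ∈ Icc 0 T) :
    ‖convolution S f t‖ ≤ M * ∫ s in (0 : ℝ)..t, ‖f s‖ := by
  rw [← intervalIntegral.integral_const_mul]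
  refine (intervalIntegral.norm_integral_le_integral_norm ht.1).trans ?_
  refine intervalIntegral.integral_mono_on ht.1
    ((hS.continuous_convolution_integrand_right hf t).norm.intervalIntegrable _ _)
    ((continuous_const.mul hf.norm).intervalIntegrable _ _) fun s hs => ?_
  exact (ContinuousLinearMap.le_opNorm _ _).trans (mul_le_mul_of_nonneg_right
    (hM _ ⟨le_max_right _ _, max_le (by linarith [hs.1, ht.2]) (ht.1.trans ht.2)⟩)
    (norm_nonneg _))

/-- Split the integral at `r`. On `[0, r]` the factor `S(t)` comes out; on `[r, t + r]` a
translation of time remains. It supplies the semigroup law for solutions of the Volterra equation.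
-/
theorem IsC0Semigroup.convolution_add (hS : IsC0Semigroup S) {f : ℝ → H}
    (hf : Continuous f) {t r : ℝ} (ht : 0 ≤ t) (hr : 0 ≤ r) :
    convolution S f (t + r) = S t (convolution S f r) + convolution S (fun s => f (s + r)) t := by
  have hc := hS.continuous_convolution_integrand_right hf
  have h1 : S t (convolution S f r) = ∫ s in (0 : ℝ)..r, S (max (t + r - s) 0) (f s) := by
    rw [convolution, ← (S t).intervalIntegral_comp_comm ((hc r).intervalIntegrable _ _)]
    refine intervalIntegral.integral_congr fun s hs => ?_
    rw [uIcc_of_le hr] at hs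
    have h2 : 0 ≤ r - s := sub_nonneg.2 hs.2
    rw [max_eq_left h2, max_eq_left (by linarith), ← hS.apply_add ht h2, add_sub_assoc]
  have h2 : convolution S (fun s => f (s + r)) t
      = ∫ s in r..(t + r), S (max (t + r - s) 0) (f s) := by
    have := intervalIntegral.integral_comp_add_right
      (fun s => S (max (t + r - s) 0) (f s)) r (a := 0) (b := t)
    rw [zero_add] at this
    rw [← this, convolution]
    simp only [add_sub_add_right_eq_sub]
  rw [h1, h2, intervalIntegral.integral_add_adjacent_intervals ((hc _).intervalIntegrable _ _)
    ((hc _).intervalIntegrable _ _)]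
  rfl

theorem IsC0Semigroup.tendsto_convolution (hS : IsC0Semigroup S) {f : ℝ → H}
    (hf : Continuous f) :
    Tendsto (fun h : ℝ => ((h⁻¹ : ℝ) : ℂ) • convolution S f h) (𝓝[>] 0) (𝓝 (f 0)) := by
  have hc := hS.continuous_convolution_integrand hf
  rw [Metric.tendsto_nhds]
  intro ε hε
  have h1 := Metric.tendsto_nhds.1 (hc.tendsto (0, 0)) (ε / 2) (by positivity)
  obtain ⟨δ, hδ, hb⟩ := Metric.eventually_nhds_iff.1 h1
  filter_upwards [Ioo_mem_nhdsGT hδ] with h hh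
  have h0 : 0 < h := hh.1
  have hbd : ∀ s ∈ uIoc 0 h, ‖S (max (h - s) 0) (f s) - f 0‖ ≤ ε / 2 := by
    intro s hs
    rw [uIoc_of_le h0.le] at hs
    have := @hb (h, s) (by
      rw [Prod.dist_eq, Real.dist_eq, Real.dist_eq, sub_zero, sub_zero, abs_of_pos h0,
        abs_of_pos hs.1, max_eq_left hs.2]
      exact hh.2)
    rw [dist_eq_norm] at this
    simpa [hS.apply_zero] using this.le
  have hn := intervalIntegral.norm_integral_le_of_norm_le_const hbd
  rw [intervalIntegral.integral_sub
    ((hS.continuous_convolution_integrand_right hf h).intervalIntegrable _ _)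
    (continuous_const.intervalIntegrable _ _), intervalIntegral.integral_const, sub_zero,
    abs_of_pos h0] at hn
  have e : ((h⁻¹ : ℝ) : ℂ) • convolution S f h - f 0
      = ((h⁻¹ : ℝ) : ℂ) • (convolution S f h - h • f 0) := by
    simp only [Complex.coe_smul, smul_sub, smul_smul, inv_mul_cancel₀ h0.ne', one_smul]
  rw [dist_eq_norm, e, norm_smul, Complex.norm_real, norm_inv, Real.norm_of_nonneg h0.le]
  calc h⁻¹ * _ ≤ h⁻¹ * (ε / 2 * h) := mul_le_mul_of_nonneg_left hn (by positivity)
    _ = ε / 2 := by field_simp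
    _ < ε := by linarith

/-- Uniqueness for the Volterra equation `y(t) = ∫_0^t S(t-s) P y(s) ds`. -/
theorem IsC0Semigroup.eq_zero_of_eq_convolution (hS : IsC0Semigroup S) (P : H →L[ℂ] H)
    {y : ℝ → H} (hy : Continuous y)
    (h : ∀ t, 0 ≤ t → y t = convolution S (fun s => P (y s)) t) {t : ℝ} (ht : 0 ≤ t) :
    y t = 0 := by
  obtain ⟨M, hM0, hM⟩ := hS.exists_bound t
  have := gronwall_integral (a := fun _ => 0) (φ := fun s => ‖y s‖) (C := M * ‖P‖) (T := t)
    continuous_const hy.norm (by positivity) (fun _ _ => le_rfl) (fun s hs => by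
      rw [zero_add]
      calc ‖y s‖ = ‖convolution S (fun s => P (y s)) s‖ := by rw [← h s hs.1]
        _ ≤ M * ∫ r in (0 : ℝ)..s, ‖P (y r)‖ := hS.norm_convolution_le (by fun_prop) hM hs
        _ ≤ M * ∫ r in (0 : ℝ)..s, ‖P‖ * ‖y r‖ := by
            refine mul_le_mul_of_nonneg_left ?_ hM0
            exact intervalIntegral.integral_mono_on hs.1
              (Continuous.intervalIntegrable (by fun_prop) _ _)
              (Continuous.intervalIntegrable (by fun_prop) _ _)
              fun r _ => ContinuousLinearMap.le_opNorm _ _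
        _ = _ := by rw [intervalIntegral.integral_const_mul]; ring) (t := t) ⟨ht, le_rfl⟩
  simpa using this

open scoped BoundedContinuousFunction in
/-- Solvability of the Volterra equation for an exponentially stable semigroup and a small
perturbation. -/
theorem IsC0Semigroup.exists_volterra_solution_of_stable (hS : IsC0Semigroup S) (P : H →L[ℂ] H)
    {M μ : ℝ} (hM : 0 ≤ M) (hμ : 0 < μ) (hSM : ∀ t, 0 ≤ t → ‖S t‖ ≤ M * Real.exp (-(μ * t)))
    (hP : M * ‖P‖ ≤ μ / 2) :
    ∃ R : ℝ → H →L[ℂ] H, (∀ x, Continuous fun t => R t x) ∧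
      ∀ x t, 0 ≤ t → R t x = S t x + convolution S (fun s => P (R s x)) t := by
  have hSM' : ∀ t, 0 ≤ t → ‖S t‖ ≤ M := fun t ht => (hSM t ht).trans <|
    mul_le_of_le_one_right hM (Real.exp_le_one_iff.2 (by have := mul_nonneg hμ.le ht; linarith))
  have hexp : ∀ t, 0 ≤ t → ∫ s in (0 : ℝ)..t, Real.exp (-(μ * (t - s))) ≤ μ⁻¹ := fun t ht => by
    have hd : ∀ s ∈ uIcc 0 t, HasDerivAt (fun s => μ⁻¹ * Real.exp (-(μ * (t - s))))
        (Real.exp (-(μ * (t - s)))) s := fun s _ => by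
      have : HasDerivAt (fun s => -(μ * (t - s))) μ s := by
        simpa using (((hasDerivAt_id s).const_sub t).const_mul μ).fun_neg
      have := this.exp.const_mul μ⁻¹
      rwa [mul_comm (Real.exp _) μ, inv_mul_cancel_left₀ hμ.ne'] at this
    rw [intervalIntegral.integral_eq_sub_of_hasDerivAt hd
      (Continuous.intervalIntegrable (by fun_prop) _ _)]
    simp only [sub_self, mul_zero, neg_zero, Real.exp_zero, mul_one]
    have : 0 ≤ μ⁻¹ * Real.exp (-(μ * (t - 0))) := by positivity
    linarith
  -- Exponential decay makes the convolution kernel integrable over the whole half-line with mass at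
  -- most `M / μ`. The smallness of `P` then gives a contraction with ratio `1/2`, uniformly in
  -- time.
  have hKbd : ∀ (v : ℝ →ᵇ H) (t : ℝ),
      ‖convolution S (fun s => P (v s)) (max t 0)‖ ≤ 1 / 2 * ‖v‖ := by
    intro v t
    set τ := max t 0
    have hτ : 0 ≤ τ := le_max_right _ _
    refine (intervalIntegral.norm_integral_le_of_norm_le hτ (g := fun s =>
      (M * ‖P‖ * ‖v‖) * Real.exp (-(μ * (τ - s)))) (ae_of_all _ fun s hs => ?_)
      (Continuous.intervalIntegrable (by fun_prop) _ _)).trans ?_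
    · have h0 : 0 ≤ τ - s := sub_nonneg.2 hs.2
      rw [max_eq_left h0]
      calc ‖S (τ - s) (P (v s))‖ ≤ (M * Real.exp (-(μ * (τ - s)))) * (‖P‖ * ‖v‖) := by
            refine (ContinuousLinearMap.le_opNorm _ _).trans
              (mul_le_mul (hSM _ h0) ?_ (norm_nonneg _) (by positivity))
            exact (ContinuousLinearMap.le_opNorm _ _).trans
              (mul_le_mul_of_nonneg_left (v.norm_coe_le_norm s) (norm_nonneg _))
        _ = _ := by ring
    · rw [intervalIntegral.integral_const_mul]
      calc _ ≤ (M * ‖P‖ * ‖v‖) * μ⁻¹ := mul_le_mul_of_nonneg_left (hexp τ hτ) (by positivity)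
        _ ≤ (μ / 2 * ‖v‖) * μ⁻¹ := by gcongr
        _ = _ := by field_simp
  have hcont : ∀ v : ℝ →ᵇ H, Continuous (convolution S fun s => P (v s)) := fun v =>
    hS.continuous_convolution (by fun_prop)
  let K : (ℝ →ᵇ H) →L[ℂ] (ℝ →ᵇ H) := LinearMap.mkContinuous
    { toFun := fun v => BoundedContinuousFunction.ofNormedAddCommGroup
        (fun t => convolution S (fun s => P (v s)) (max t 0))
        ((hcont v).comp (by fun_prop)) (1 / 2 * ‖v‖) (hKbd v)
      map_add' := fun v w => by
        ext t
        have h1 := hS.continuous_convolution_integrand_right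
          (f := fun s => P (v s)) (by fun_prop) (max t 0)
        have h2 := hS.continuous_convolution_integrand_right
          (f := fun s => P (w s)) (by fun_prop) (max t 0)
        simp only [BoundedContinuousFunction.coe_ofNormedAddCommGroup,
          BoundedContinuousFunction.coe_add, Pi.add_apply, convolution, _root_.map_add]
        exact intervalIntegral.integral_add (h1.intervalIntegrable _ _)
          (h2.intervalIntegrable _ _)
      map_smul' := fun c v => by
        ext t
        simp only [BoundedContinuousFunction.coe_ofNormedAddCommGroup,
          BoundedContinuousFunction.coe_smul, convolution, map_smul, RingHom.id_apply]
        exact intervalIntegral.integral_smul c _ } (1 / 2)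
    fun v => BoundedContinuousFunction.norm_ofNormedAddCommGroup_le _ (by positivity) (hKbd v)
  have hK : ‖K‖ < 1 := (LinearMap.mkContinuous_norm_le _ (by norm_num) _).trans_lt (by norm_num)
  let O : H →L[ℂ] (ℝ →ᵇ H) := LinearMap.mkContinuous
    { toFun := fun x => BoundedContinuousFunction.ofNormedAddCommGroup
        (fun t => S (max t 0) x) (hS.continuous_orbit x) (M * ‖x‖)
        (fun t => (ContinuousLinearMap.le_opNorm _ _).trans
          (mul_le_mul_of_nonneg_right (hSM' _ (le_max_right _ _)) (norm_nonneg _)))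
      map_add' := fun x y => by ext t; simp
      map_smul' := fun c x => by ext t; simp } M
    fun x => BoundedContinuousFunction.norm_ofNormedAddCommGroup_le _ (by positivity) fun t =>
      (ContinuousLinearMap.le_opNorm _ _).trans
          (mul_le_mul_of_nonneg_right (hSM' _ (le_max_right _ _)) (norm_nonneg _))
  -- The solution is `(1 - K)⁻¹` applied to the unperturbed orbit. Working in one Banach space of
  -- functions makes its value at time `t` a bounded linear function of `x` at no extra cost.
  let J : (ℝ →ᵇ H) →L[ℂ] (ℝ →ᵇ H) := ↑(Units.oneSub K hK)⁻¹
  have hJ : ∀ v, J v = v + K (J v) := fun v => by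
    have h1 : (1 - K) * J = 1 := (Units.oneSub K hK).mul_inv
    have h2 := congrArg (fun L : (ℝ →ᵇ H) →L[ℂ] (ℝ →ᵇ H) => L v) h1
    have h3 : J v - K (J v) = v := h2
    exact eq_add_of_sub_eq h3
  refine ⟨fun t => (BoundedContinuousFunction.evalCLM ℂ t).comp (J.comp O), fun x => ?_,
    fun x t ht => ?_⟩
  · exact (J (O x)).continuous
  · have h1 : J (O x) t = O x t + K (J (O x)) t := by
      conv_lhs => rw [hJ]
      rfl
    have h2 : O x t = S (max t 0) x := rfl
    have h3 : K (J (O x)) t = convolution S (fun s => P (J (O x) s)) (max t 0) := rfl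
    rw [h2, h3, max_eq_left ht] at h1
    exact h1

end BoundedPerturbation

/-! ### Generation of a semigroup by a bounded perturbation -/

section PerturbedSemigroup

variable {H : Type*} [NormedAddCommGroup H] [InnerProductSpace ℂ H]
  {S : ℝ → H →L[ℂ] H} {A : H →ₗ.[ℂ] H}

theorem mem_graph_perturb_iff (P : H →L[ℂ] H) {x y : H} :
    (x, y) ∈ (perturb A P).graph ↔ (x, y - P x) ∈ A.graph := by
  simp only [LinearPMap.mem_graph_iff]
  constructor
  · rintro ⟨w, rfl, rfl⟩
    exact ⟨w, rfl, (add_sub_cancel_left (P w) (A w)).symm⟩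
  · rintro ⟨w, rfl, hw⟩
    exact ⟨w, rfl, (congrArg (P w + ·) hw).trans (add_sub_cancel (P w) y)⟩

/-- Rescaling of a `C₀`-semigroup. -/
theorem IsC0Semigroup.exp_smul (hS : IsC0Semigroup S) (c : ℝ) :
    IsC0Semigroup fun t => Real.exp (c * t) • S t where
  map_zero := by simp [hS.map_zero]
  map_add := fun s t hs ht => by
    rw [hS.map_add s t hs ht, mul_add, Real.exp_add, smul_mul_smul_comm]
  continuousOn := fun x => by
    have h1 : Continuous fun t : ℝ => Real.exp (c * t) := by fun_prop
    exact h1.continuousOn.smul (hS.continuousOn x)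

/-- The weights `e^{c(t-s)}` and `e^{cs}` multiply to `e^{ct}`, free of `s`; so a Volterra equation
may be rescaled to the exponentially stable case. -/
theorem convolution_exp_smul {f : ℝ → H} (c : ℝ) {t : ℝ} (ht : 0 ≤ t) :
    convolution (fun r => Real.exp (c * r) • S r) (fun s => Real.exp (c * s) • f s) t
      = Real.exp (c * t) • convolution S f t := by
  rw [convolution, convolution, ← intervalIntegral.integral_smul]
  refine intervalIntegral.integral_congr fun s hs => ?_
  rw [uIcc_of_le ht] at hs
  simp only [max_eq_left (sub_nonneg.2 hs.2), _root_.smul_apply,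
    ContinuousLinearMap.map_smul_of_tower, smul_smul, ← Real.exp_add]
  congr 2
  ring

variable [CompleteSpace H]

/-- Solvability of the Volterra equation `R(t) x = S(t) x + ∫_0^t S(t-s) P R(s) x ds`. -/
theorem IsC0Semigroup.exists_volterra_solution (hS : IsC0Semigroup S) (P : H →L[ℂ] H) :
    ∃ R : ℝ → H →L[ℂ] H, (∀ x, Continuous fun t => R t x) ∧
      ∀ x t, 0 ≤ t → R t x = S t x + convolution S (fun s => P (R s x)) t := by
  obtain ⟨M, ω, hM, hω, hSM⟩ := hS.exists_growth_bound
  -- Rescaling by `e^{-(ω+μ)t}` leaves decay at rate `μ`, and this `μ` makes `M ‖P‖ ≤ μ / 2`. The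
  -- rescaling is undone at the end.
  set μ : ℝ := 2 * (M * ‖P‖) + 1
  have hμ : 0 < μ := by positivity
  obtain ⟨Q, hQc, hQ⟩ := (hS.exp_smul (-(ω + μ))).exists_volterra_solution_of_stable P hM hμ
    (fun t ht => by
      rw [norm_smul, Real.norm_of_nonneg (Real.exp_pos _).le]
      calc _ ≤ Real.exp (-(ω + μ) * t) * (M * Real.exp (ω * t)) :=
            mul_le_mul_of_nonneg_left (hSM t ht) (Real.exp_pos _).le
        _ = M * (Real.exp (-(ω + μ) * t) * Real.exp (ω * t)) := by ring
        _ = _ := by rw [← Real.exp_add]; congr 2; ring)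
    (by linarith)
  have hc : ∀ t : ℝ, Real.exp ((ω + μ) * t) * Real.exp (-(ω + μ) * t) = 1 := fun t => by
    rw [← Real.exp_add, neg_mul, add_neg_cancel, Real.exp_zero]
  refine ⟨fun t => Real.exp ((ω + μ) * t) • Q t, fun x => ?_, fun x t ht => ?_⟩
  · have h1 : Continuous fun t : ℝ => Real.exp ((ω + μ) * t) := by fun_prop
    exact h1.smul (hQc x)
  · have h1 := convolution_exp_smul (S := fun t => Real.exp (-(ω + μ) * t) • S t)
      (f := fun s => P (Q s x)) (ω + μ) ht
    simp only [smul_smul, hc, one_smul] at h1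
    simp only [_root_.smul_apply, ContinuousLinearMap.map_smul_of_tower]
    change _ = S t x + convolution (fun r => S r) _ t
    rw [h1, hQ x t ht, smul_add, _root_.smul_apply, smul_smul, hc, one_smul]

/-- A bounded perturbation of the generator of a `C₀`-semigroup generates a `C₀`-semigroup. -/
theorem GeneratesC0Semigroup.perturb (hA : GeneratesC0Semigroup A) (P : H →L[ℂ] H) :
    GeneratesC0Semigroup (perturb A P) := by
  obtain ⟨S, hS, hG⟩ := hA
  obtain ⟨R, hRc, hR⟩ := hS.exists_volterra_solution P
  have hPc : ∀ x, Continuous fun s => P (R s x) := fun x => P.continuous.comp (hRc x)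
  have hR0 : ∀ x, R 0 x = x := fun x => by
    rw [hR x 0 le_rfl, hS.apply_zero, convolution, intervalIntegral.integral_same, add_zero]
  refine ⟨R, ⟨ContinuousLinearMap.ext hR0, fun s t hs ht => ?_,
    fun x => (hRc x).continuousOn⟩, fun x y => ?_⟩
  · ext x
    -- The semigroup law follows from uniqueness: this difference, as a function of `r`, solves the
    -- homogeneous Volterra equation.
    have hd : Continuous fun r => R (r + t) x - R r (R t x) :=
      ((hRc x).comp (continuous_id.add continuous_const)).sub (hRc _)
    refine sub_eq_zero.1 (hS.eq_zero_of_eq_convolution P hd (fun r hr => ?_) hs)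
    simp only [map_sub]
    rw [hS.convolution_sub (f := fun s => P (R (s + t) x))
      ((hPc x).comp (continuous_id.add continuous_const)) (hPc _), hR x (r + t) (add_nonneg hr ht),
      hR (R t x) r hr, hS.convolution_add (hPc x) hr ht, hS.apply_add hr ht]
    have e : S r (R t x) = S r (S t x) + S r (convolution S (fun s => P (R s x)) t) := by
      rw [hR x t ht, _root_.map_add]
    rw [e]
    abel
  · rw [mem_graph_perturb_iff, hG]
    -- The difference quotients of `R` and `S` differ by the convolution divided by `t`, which tends
    -- to `P x`. So one converges exactly when the other does.
    have h1 := hS.tendsto_convolution (hPc x)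
    rw [hR0] at h1
    have e : ∀ᶠ t : ℝ in 𝓝[>] 0, ((t⁻¹ : ℝ) : ℂ) • (R t x - x)
        = ((t⁻¹ : ℝ) : ℂ) • (S t x - x)
          + ((t⁻¹ : ℝ) : ℂ) • convolution S (fun s => P (R s x)) t := by
      filter_upwards [self_mem_nhdsWithin] with t ht
      rw [hR x t (le_of_lt ht), ← smul_add]
      congr 1; abel
    constructor
    · intro h
      have := (h.add h1).congr' (e.mono fun t ht => ht.symm)
      rwa [sub_add_cancel] at this
    · intro h
      refine (h.sub h1).congr' (e.mono fun t ht => ?_)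
      rw [ht, add_sub_cancel_right]

end PerturbedSemigroup

/-! ### Convergence and continuity in the graph norm -/

section GraphNorm

variable {E F : Type*} [NormedAddCommGroup E] [InnerProductSpace ℂ E]
  [NormedAddCommGroup F] [InnerProductSpace ℂ F]

theorem GraphDomain.op_of (A : E →ₗ.[ℂ] F) {x : E} {y : F} (h : (x, y) ∈ A.graph) :
    GraphDomain.op A (GraphDomain.of A x) = y := by
  have hx := LinearPMap.mem_domain_of_mem_graph h
  have e : GraphDomain.of A x = (⟨x, hx⟩ : A.domain) := dif_pos hx
  exact (congrArg (GraphDomain.op A) e).trans ((LinearPMap.image_iff hx).2 h).symm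

theorem GraphDomain.incl_of_graph (A : E →ₗ.[ℂ] F) {x : E} {y : F} (h : (x, y) ∈ A.graph) :
    GraphDomain.incl A (GraphDomain.of A x) = x :=
  GraphDomain.incl_of A (LinearPMap.mem_domain_of_mem_graph h)

theorem GraphDomain.incl_injective (A : E →ₗ.[ℂ] F) : Function.Injective (GraphDomain.incl A) :=
  Subtype.val_injective

theorem GraphDomain.incl_mem (A : E →ₗ.[ℂ] F) (z : GraphDomain A) :
    GraphDomain.incl A z ∈ A.domain := Subtype.property _

theorem GraphDomain.of_add (A : E →ₗ.[ℂ] F) {x y : E} (hx : x ∈ A.domain) (hy : y ∈ A.domain) :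
    GraphDomain.of A (x + y) = GraphDomain.of A x + GraphDomain.of A y :=
  GraphDomain.incl_injective A (by
    rw [map_add, GraphDomain.incl_of A hx, GraphDomain.incl_of A hy,
      GraphDomain.incl_of A (A.domain.add_mem hx hy)])

theorem GraphDomain.of_smul (A : E →ₗ.[ℂ] F) (c : ℂ) {x : E} (hx : x ∈ A.domain) :
    GraphDomain.of A (c • x) = c • GraphDomain.of A x :=
  GraphDomain.incl_injective A (by
    rw [map_smul, GraphDomain.incl_of A hx, GraphDomain.incl_of A (A.domain.smul_mem c hx)])

theorem GraphDomain.of_sub (A : E →ₗ.[ℂ] F) {x y : E} (hx : x ∈ A.domain) (hy : y ∈ A.domain) :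
    GraphDomain.of A (x - y) = GraphDomain.of A x - GraphDomain.of A y :=
  GraphDomain.incl_injective A (by
    rw [map_sub, GraphDomain.incl_of A hx, GraphDomain.incl_of A hy,
      GraphDomain.incl_of A (A.domain.sub_mem hx hy)])

theorem GraphDomain.isInducing_toGraph (A : E →ₗ.[ℂ] F) :
    IsInducing (GraphDomain.toGraph A) := ⟨rfl⟩

theorem GraphDomain.tendsto_nhds_iff (A : E →ₗ.[ℂ] F) {X : Type*} {l : Filter X}
    {f : X → GraphDomain A} {z : GraphDomain A} :
    Tendsto f l (𝓝 z) ↔ Tendsto (fun a => GraphDomain.incl A (f a)) l (𝓝 (GraphDomain.incl A z)) ∧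
      Tendsto (fun a => GraphDomain.op A (f a)) l (𝓝 (GraphDomain.op A z)) := by
  rw [(GraphDomain.isInducing_toGraph A).tendsto_nhds_iff]
  constructor
  · intro h
    have h2 := ((WithLp.prod_continuous_ofLp 2 E F).tendsto _).comp h
    exact ⟨(continuous_fst.tendsto _).comp h2, (continuous_snd.tendsto _).comp h2⟩
  · rintro ⟨h1, h2⟩
    exact ((WithLp.prod_continuous_toLp 2 E F).tendsto _).comp (h1.prodMk_nhds h2)

/-- Continuity in the graph norm. -/
theorem GraphDomain.continuousOn_of (A : E →ₗ.[ℂ] F) {X : Type*} [TopologicalSpace X] {s : Set X}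
    {f : X → E} {g : X → F} (h : ∀ a ∈ s, (f a, g a) ∈ A.graph) (hf : ContinuousOn f s)
    (hg : ContinuousOn g s) : ContinuousOn (fun a => GraphDomain.of A (f a)) s := by
  intro a ha
  rw [ContinuousWithinAt, GraphDomain.tendsto_nhds_iff, GraphDomain.incl_of_graph A (h a ha),
    GraphDomain.op_of A (h a ha)]
  constructor
  · refine (hf a ha).tendsto.congr' ?_
    filter_upwards [self_mem_nhdsWithin] with b hb
    exact (GraphDomain.incl_of_graph A (h b hb)).symm
  · refine (hg a ha).tendsto.congr' ?_
    filter_upwards [self_mem_nhdsWithin] with b hb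
    exact (GraphDomain.op_of A (h b hb)).symm

end GraphNorm

/-! ### Duhamel's formula for the adjoint semigroups -/

section Duhamel

variable {H : Type*} [NormedAddCommGroup H] [InnerProductSpace ℂ H] [CompleteSpace H]
  {S : ℝ → H →L[ℂ] H} {A : H →ₗ.[ℂ] H}

theorem inner_intervalIntegral_left {f : ℝ → H} {a b : ℝ} (hf : IntervalIntegrable f volume a b)
    (x : H) : inner ℂ (∫ s in a..b, f s) x = ∫ s in a..b, inner ℂ (f s) x := by
  have h : inner ℂ x (∫ s in a..b, f s) = ∫ s in a..b, inner ℂ x (f s) :=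
    ((innerSL ℂ x).intervalIntegral_comp_comm hf).symm
  rw [← inner_conj_symm, h, ← intervalIntegral.intervalIntegral_conj]
  simp only [inner_conj_symm]

theorem inner_convolution_adjoint (hS : IsC0Semigroup S) (hA : IsGenerator A S) {f : ℝ → H}
    (hf : Continuous f) (t : ℝ) (x : H) :
    inner ℂ (convolution (adjointSemigroup S) f t) x
      = ∫ s in (0 : ℝ)..t, inner ℂ (f s) (S (max (t - s) 0) x) := by
  rw [convolution, inner_intervalIntegral_left
    (((hS.adjoint hA).continuous_convolution_integrand_right hf t).intervalIntegrable _ _)]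
  simp only [inner_adjointSemigroup]

theorem IsC0Semigroup.hasDerivAt_orbit_reverse (hS : IsC0Semigroup S) (hA : IsGenerator A S)
    {x y : H} (hx : (x, y) ∈ A.graph) {s t : ℝ} (hst : s < t) :
    HasDerivAt (fun s => S (max (t - s) 0) x) (-S (max (t - s) 0) y) s := by
  have h1 := hS.hasDerivAt_orbit hA hx (sub_pos.2 hst)
  rw [max_eq_left (sub_nonneg.2 hst.le)]
  have h2 : HasDerivAt (fun s : ℝ => t - s) (-1) s := by
    simpa using (hasDerivAt_id s).const_sub t
  exact (h1.scomp s h2).congr_deriv (by rw [neg_one_smul])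

/-- Convolution of the adjoint semigroup with a `C¹` function takes values in `D(A*)`. -/
theorem convolution_adjoint_mem_graph (hS : IsC0Semigroup S) (hA : IsGenerator A S)
    {f f' : ℝ → H} (hf : Continuous f) (hf' : Continuous f') {t : ℝ} (ht : 0 ≤ t)
    (hd : ∀ s ∈ Ioo 0 t, HasDerivAt f (f' s) s) :
    (convolution (adjointSemigroup S) f t,
      adjointSemigroup S t (f 0) - f t + convolution (adjointSemigroup S) f' t)
      ∈ A.adjoint.graph := by
  rw [mem_graph_adjoint_iff (hS.dense_domain hA)]
  intro x y hxy
  have hc : ∀ v : H, Continuous fun s => S (max (t - s) 0) v := fun v =>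
    hS.continuous_apply (continuous_const.sub continuous_id) continuous_const
  have hi1 : IntervalIntegrable (fun s => inner ℂ (f' s) (S (max (t - s) 0) x)) volume 0 t :=
    (hf'.inner (𝕜 := ℂ) (hc x)).intervalIntegrable _ _
  have hi2 : IntervalIntegrable (fun s => inner ℂ (f s) (S (max (t - s) 0) y)) volume 0 t :=
    (hf.inner (𝕜 := ℂ) (hc y)).intervalIntegrable _ _
  -- Integration by parts, tested against `x ∈ D(A)`: along `s ↦ ⟪f(s), S(t-s) x⟫` one derivative
  -- falls on `f` and the other produces `-A x`. The endpoint values give the boundary terms `S(t)*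
  -- f(0)` and `f(t)`.
  have h := intervalIntegral.integral_eq_sub_of_hasDerivAt_of_le
    (f := fun s => inner ℂ (f s) (S (max (t - s) 0) x))
    (f' := fun s => inner ℂ (f' s) (S (max (t - s) 0) x)
      - inner ℂ (f s) (S (max (t - s) 0) y)) ht
    (hf.inner (𝕜 := ℂ) (hc x)).continuousOn
    (fun s hs => by
      have := (hd s hs).inner ℂ (hS.hasDerivAt_orbit_reverse hA hxy hs.2)
      rw [inner_neg_right] at this
      refine this.congr_deriv ?_
      exact neg_add_eq_sub _ _)
    (hi1.sub hi2)
  rw [intervalIntegral.integral_sub hi1 hi2, ← inner_convolution_adjoint hS hA hf',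
    ← inner_convolution_adjoint hS hA hf, sub_self, max_self, sub_zero, max_eq_left ht,
    hS.apply_zero] at h
  rw [inner_add_left, inner_sub_left, inner_adjointSemigroup]
  linear_combination h

/-- Duhamel's formula `S_{A+P}(t)* z = S_A(t)* z + ∫_0^t S_A(t-s)* P* S_{A+P}(s)* z ds` for
`z ∈ D(A*)`. -/
theorem duhamel_adjoint (hS : IsC0Semigroup S) (hA : IsGenerator A S) {P : H →L[ℂ] H}
    {R : ℝ → H →L[ℂ] H} (hR : IsC0Semigroup R) (hAP : IsGenerator (perturb A P) R)
    {z w : H} (hz : (z, w) ∈ (perturb A P).adjoint.graph) {t : ℝ} (ht : 0 ≤ t) :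
    adjointSemigroup R t z = adjointSemigroup S t z
      + convolution (adjointSemigroup S)
        (fun s => ContinuousLinearMap.adjoint P (adjointSemigroup R (max s 0) z)) t := by
  have hR' := hR.adjoint hAP
  have hAP' := hAP.adjoint hR
  refine (hS.dense_domain hA).eq_of_inner_left (𝕜 := ℂ) fun x hx => ?_
  obtain ⟨y, hxy⟩ := LinearPMap.mem_domain_iff.1 hx
  have hc : ∀ v : H, Continuous fun s => S (max (t - s) 0) v := fun v =>
    hS.continuous_apply (continuous_const.sub continuous_id) continuous_const
  have hf : Continuous fun s => ContinuousLinearMap.adjoint P (adjointSemigroup R (max s 0) z) :=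
    (ContinuousLinearMap.continuous _).comp (hR'.continuous_orbit z)
  -- The pairing `⟪R(s)* z, S(t-s) x⟫` moves from `⟪z, S(t) x⟫` to `⟪R(t)* z, x⟫`. In its derivative
  -- the contributions of `A` cancel, and only the bounded term with `P*` survives.
  have h := intervalIntegral.integral_eq_sub_of_hasDerivAt_of_le
    (f := fun s => inner ℂ (adjointSemigroup R (max s 0) z) (S (max (t - s) 0) x))
    (f' := fun s => inner ℂ (ContinuousLinearMap.adjoint P (adjointSemigroup R (max s 0) z))
      (S (max (t - s) 0) x)) ht
    ((hR'.continuous_orbit z).inner (𝕜 := ℂ) (hc x)).continuousOn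
    (fun s hs => by
      have h1 := (hR'.hasDerivAt_orbit hAP' hz hs.1).inner ℂ
        (hS.hasDerivAt_orbit_reverse hA hxy hs.2)
      have hp : (S (max (t - s) 0) x, S (max (t - s) 0) y + P (S (max (t - s) 0) x))
          ∈ (perturb A P).graph := by
        rw [mem_graph_perturb_iff, add_sub_cancel_right]
        exact hS.apply_mem_graph hA (le_max_right _ _) hxy
      have h2 := (mem_graph_adjoint_iff (hR.dense_domain hAP)).1
        (hR'.apply_mem_graph hAP' hs.1.le hz) _ _ hp
      rw [h2, inner_neg_right, max_eq_left hs.1.le, inner_add_right] at h1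
      refine h1.congr_deriv ?_
      rw [ContinuousLinearMap.adjoint_inner_left, max_eq_left hs.1.le]
      ring)
    ((hf.inner (𝕜 := ℂ) (hc x)).intervalIntegrable _ _)
  rw [← inner_convolution_adjoint hS hA hf, sub_self, max_self, sub_zero, max_eq_left ht,
    hS.apply_zero, hR'.apply_zero] at h
  rw [inner_add_left, inner_adjointSemigroup (S := S), h]
  ring

theorem mem_graph_perturb_adjoint_iff (hA : Dense (A.domain : Set H)) (P : H →L[ℂ] H) {z w : H} :
    (z, w) ∈ (perturb A P).adjoint.graph
      ↔ (z, w - ContinuousLinearMap.adjoint P z) ∈ A.adjoint.graph := by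
  rw [mem_graph_adjoint_iff (A := perturb A P) hA, mem_graph_adjoint_iff hA]
  constructor
  · intro h x y hxy
    rw [inner_sub_left, ContinuousLinearMap.adjoint_inner_left,
      h x (y + P x) ((mem_graph_perturb_iff P).2 (by rwa [add_sub_cancel_right])), inner_add_right,
      add_sub_cancel_right]
  · intro h x y hxy
    have := h x _ ((mem_graph_perturb_iff P).1 hxy)
    rw [inner_sub_left, ContinuousLinearMap.adjoint_inner_left, inner_sub_right] at this
    exact sub_left_injective this

end Duhamel

/-! ### Two facts on integrals of real functions -/

section Integrals

/-- Cauchy–Schwarz, read off from the nonnegativity of the variance `∫ (φ - I/t)²`. -/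
theorem sq_integral_le {φ : ℝ → ℝ} (hφ : Continuous φ) {t : ℝ} (ht : 0 ≤ t) :
    (∫ s in (0 : ℝ)..t, φ s) ^ 2 ≤ t * ∫ s in (0 : ℝ)..t, φ s ^ 2 := by
  rcases ht.eq_or_lt with rfl | h0
  · simp
  set I := ∫ s in (0 : ℝ)..t, φ s
  have h1 : 0 ≤ ∫ s in (0 : ℝ)..t, (φ s - I / t) ^ 2 :=
    intervalIntegral.integral_nonneg ht fun s _ => sq_nonneg _
  have h2 : ∫ s in (0 : ℝ)..t, (φ s - I / t) ^ 2
      = (∫ s in (0 : ℝ)..t, φ s ^ 2) - 2 * (I / t) * I + t * (I / t) ^ 2 := by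
    have e : ∀ s, (φ s - I / t) ^ 2 = φ s ^ 2 - 2 * (I / t) * φ s + (I / t) ^ 2 :=
      fun s => by ring
    simp only [e]
    rw [intervalIntegral.integral_add (Continuous.intervalIntegrable (by fun_prop) _ _)
      (Continuous.intervalIntegrable (by fun_prop) _ _), intervalIntegral.integral_sub
      (Continuous.intervalIntegrable (by fun_prop) _ _)
      (Continuous.intervalIntegrable (by fun_prop) _ _), intervalIntegral.integral_const_mul,
      intervalIntegral.integral_const, sub_zero, smul_eq_mul]
  rw [h2] at h1
  have h3 : t * ((∫ s in (0 : ℝ)..t, φ s ^ 2) - 2 * (I / t) * I + t * (I / t) ^ 2)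
      = t * (∫ s in (0 : ℝ)..t, φ s ^ 2) - I ^ 2 := by
    field_simp; ring
  have := mul_nonneg ht h1
  linarith

/-- Exchange of the order of integration over a triangle. -/
theorem integral_triangle_swap {q : ℝ × ℝ → ℝ} (hq : Continuous q) {T : ℝ} (hT : 0 ≤ T) :
    ∫ t in (0 : ℝ)..T, ∫ s in (0 : ℝ)..t, q (t, s)
      = ∫ s in (0 : ℝ)..T, ∫ t in s..T, q (t, s) := by
  set F : ℝ × ℝ → ℝ := indicator {p | p.2 ≤ p.1} q
  have hm : MeasurableSet {p : ℝ × ℝ | p.2 ≤ p.1} := measurableSet_le measurable_snd measurable_fst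
  have hF : Integrable F ((volume.restrict (Ioc 0 T)).prod (volume.restrict (Ioc 0 T))) := by
    refine Integrable.indicator ?_ hm
    rw [Measure.prod_restrict]
    have hc : IntegrableOn q (Icc 0 T ×ˢ Icc 0 T) (volume.prod volume) :=
      hq.continuousOn.integrableOn_compact (isCompact_Icc.prod isCompact_Icc)
    exact hc.mono_set (prod_mono Ioc_subset_Icc_self Ioc_subset_Icc_self)
  have hswap := integral_integral_swap (f := fun t s => F (t, s)) hF
  have h1 : ∫ t in (0 : ℝ)..T, ∫ s in (0 : ℝ)..t, q (t, s)
      = ∫ t in Ioc 0 T, ∫ s in Ioc 0 T, F (t, s) := by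
    rw [intervalIntegral.integral_of_le hT]
    refine setIntegral_congr_fun measurableSet_Ioc fun t ht => ?_
    have e : (fun s => F (t, s)) = indicator (Iic t) fun s => q (t, s) := by
      ext s; simp only [F, indicator, mem_ofPred_eq, mem_Iic]
    rw [e, intervalIntegral.integral_of_le ht.1.le, setIntegral_indicator measurableSet_Iic]
    congr 2
    ext s
    exact ⟨fun h => ⟨⟨h.1, h.2.trans ht.2⟩, h.2⟩, fun h => ⟨h.1.1, h.2⟩⟩
  have h2 : ∫ s in (0 : ℝ)..T, ∫ t in s..T, q (t, s)
      = ∫ s in Ioc 0 T, ∫ t in Ioc 0 T, F (t, s) := by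
    rw [intervalIntegral.integral_of_le hT]
    refine setIntegral_congr_fun measurableSet_Ioc fun s hs => ?_
    have e : (fun t => F (t, s)) = indicator (Ici s) fun t => q (t, s) := by
      ext t; simp only [F, indicator, mem_ofPred_eq, mem_Ici]
    rw [e, intervalIntegral.integral_of_le hs.2, setIntegral_indicator measurableSet_Ici,
      ← integral_Icc_eq_integral_Ioc]
    congr 2
    ext t
    exact ⟨fun h => ⟨⟨hs.1.trans_le h.1, h.2⟩, h.1⟩, fun h => ⟨h.2, h.1.2⟩⟩
  rw [h1, h2, hswap]

end Integrals

/-! ### Observation inequalities for orbits and convolutions -/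

section Observation

variable {H U : Type*} [NormedAddCommGroup H] [InnerProductSpace ℂ H]
  [NormedAddCommGroup U] [InnerProductSpace ℂ U] {S : ℝ → H →L[ℂ] H} {G : H →ₗ.[ℂ] H}

/-- The observation of an orbit starting in `D(G)` is continuous. -/
theorem IsC0Semigroup.continuousOn_observation (hS : IsC0Semigroup S) (hG : IsGenerator G S)
    (C : GraphDomain G →L[ℂ] U) {z : H} (hz : z ∈ G.domain) :
    ContinuousOn (fun t => C (GraphDomain.of G (S t z))) (Ici 0) := by
  obtain ⟨w, hw⟩ := LinearPMap.mem_domain_iff.1 hz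
  exact C.continuous.comp_continuousOn (GraphDomain.continuousOn_of G
    (fun t ht => hS.apply_mem_graph hG ht hw) (hS.continuousOn z) (hS.continuousOn w))

theorem IsC0Semigroup.apply_mem_domain (hS : IsC0Semigroup S) (hG : IsGenerator G S)
    {z : H} (hz : z ∈ G.domain) {t : ℝ} (ht : 0 ≤ t) : S t z ∈ G.domain := by
  obtain ⟨w, hw⟩ := LinearPMap.mem_domain_iff.1 hz
  exact LinearPMap.mem_domain_of_mem_graph (hS.apply_mem_graph hG ht hw)

theorem GraphDomain.norm_le (A : H →ₗ.[ℂ] H) (z : GraphDomain A) :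
    ‖z‖ ≤ ‖GraphDomain.incl A z‖ + ‖GraphDomain.op A z‖ := by
  rw [GraphDomain.norm_eq]
  refine Real.sqrt_le_iff.2 ⟨by positivity, ?_⟩
  nlinarith [norm_nonneg (GraphDomain.incl A z), norm_nonneg (GraphDomain.op A z)]

/-- An observation inequality on one time interval implies one on every time interval. -/
theorem IsC0Semigroup.exists_observation_bound (hS : IsC0Semigroup S)
    (hG : IsGenerator G S) (C : GraphDomain G →L[ℂ] U) {T₀ c₀ : ℝ} (hT₀ : 0 < T₀) (hc₀ : 0 ≤ c₀)
    (h : ∀ z ∈ G.domain,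
      ∫ t in (0 : ℝ)..T₀, ‖C (GraphDomain.of G (S t z))‖ ^ 2 ≤ c₀ * ‖z‖ ^ 2)
    {T : ℝ} (hT : 0 ≤ T) :
    ∃ c, 0 ≤ c ∧ ∀ z ∈ G.domain,
      ∫ t in (0 : ℝ)..T, ‖C (GraphDomain.of G (S t z))‖ ^ 2 ≤ c * ‖z‖ ^ 2 := by
  have hi : ∀ z ∈ G.domain, ∀ a b, 0 ≤ a → 0 ≤ b → IntervalIntegrable
      (fun t => ‖C (GraphDomain.of G (S t z))‖ ^ 2) volume a b := fun z hz a b ha hb =>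
    (((hS.continuousOn_observation hG C hz).norm.pow 2).mono fun t ht =>
      (le_min ha hb).trans ht.1).intervalIntegrable
  have key : ∀ n : ℕ, ∃ c, 0 ≤ c ∧ ∀ z ∈ G.domain,
      ∫ t in (0 : ℝ)..(n * T₀), ‖C (GraphDomain.of G (S t z))‖ ^ 2 ≤ c * ‖z‖ ^ 2 := by
    intro n
    induction n with
    | zero => exact ⟨0, le_rfl, fun z _ => by simp⟩
    | succ n ih =>
      obtain ⟨c, hc, hn⟩ := ih
      -- The part of the orbit after time `T₀` is the orbit of `S(T₀) z` over `n` intervals, to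
      -- which the induction hypothesis applies.
      refine ⟨c₀ + c * ‖S T₀‖ ^ 2, by positivity, fun z hz => ?_⟩
      have e : ∫ t in T₀..((n + 1 : ℕ) * T₀), ‖C (GraphDomain.of G (S t z))‖ ^ 2
          = ∫ t in (0 : ℝ)..(n * T₀), ‖C (GraphDomain.of G (S t (S T₀ z)))‖ ^ 2 := by
        have := intervalIntegral.integral_comp_add_right
          (fun t => ‖C (GraphDomain.of G (S t z))‖ ^ 2) T₀ (a := 0) (b := n * T₀)
        rw [zero_add, ← add_one_mul, ← Nat.cast_add_one] at this
        rw [← this]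
        refine intervalIntegral.integral_congr fun t ht => ?_
        rw [uIcc_of_le (by positivity)] at ht
        simp only [hS.apply_add ht.1 hT₀.le]
      rw [← intervalIntegral.integral_add_adjacent_intervals (hi z hz 0 T₀ le_rfl hT₀.le)
        (hi z hz T₀ _ hT₀.le (by positivity)), e, add_mul, mul_assoc, ← mul_pow]
      refine add_le_add (h z hz) ((hn _ (hS.apply_mem_domain hG hz hT₀.le)).trans ?_)
      exact mul_le_mul_of_nonneg_left
        (pow_le_pow_left₀ (norm_nonneg _) ((S T₀).le_opNorm z) 2) hc
  obtain ⟨n, hn⟩ := exists_nat_ge (T / T₀)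
  obtain ⟨c, hc, hb⟩ := key n
  refine ⟨c, hc, fun z hz => le_trans ?_ (hb z hz)⟩
  exact intervalIntegral.integral_mono_interval le_rfl hT ((div_le_iff₀ hT₀).1 hn)
    (ae_of_all _ fun r => sq_nonneg _) (hi z hz _ _ le_rfl (by positivity))

variable [CompleteSpace H] [CompleteSpace U]

/-- An `L²` bound for a bounded observation of a convolution. -/
theorem IsC0Semigroup.integral_norm_sq_convolution_le (hS : IsC0Semigroup S) (D : H →L[ℂ] U)
    {T c : ℝ} (hT : 0 ≤ T)
    (hD : ∀ x, ∫ r in (0 : ℝ)..T, ‖D (S (max r 0) x)‖ ^ 2 ≤ c * ‖x‖ ^ 2)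
    {f : ℝ → H} (hf : Continuous f) :
    ∫ t in (0 : ℝ)..T, ‖D (convolution S f t)‖ ^ 2
      ≤ T * (c * ∫ s in (0 : ℝ)..T, ‖f s‖ ^ 2) := by
  set q : ℝ × ℝ → ℝ := fun p => ‖D (S (max (p.1 - p.2) 0) (f p.2))‖ ^ 2
  have hk : Continuous fun p : ℝ × ℝ => ‖D (S (max (p.1 - p.2) 0) (f p.2))‖ :=
    (D.continuous.comp (hS.continuous_convolution_integrand hf)).norm
  have hq : Continuous q := hk.pow 2
  -- Cauchy–Schwarz in `s` comes first. After the integrals are exchanged, the inner one runs along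
  -- the orbit of the fixed vector `f s`, where the observation inequality applies.
  have h1 : ∀ t ∈ Icc 0 T, ‖D (convolution S f t)‖ ^ 2 ≤ T * ∫ s in (0 : ℝ)..t, q (t, s) := by
    intro t ht
    have e : D (convolution S f t) = ∫ s in (0 : ℝ)..t, D (S (max (t - s) 0) (f s)) :=
      (D.intervalIntegral_comp_comm
        ((hS.continuous_convolution_integrand_right hf t).intervalIntegrable _ _)).symm
    have hkt : Continuous fun s => ‖D (S (max (t - s) 0) (f s))‖ :=
      hk.comp (Continuous.prodMk_right t)
    have h2 : ‖D (convolution S f t)‖ ≤ ∫ s in (0 : ℝ)..t, ‖D (S (max (t - s) 0) (f s))‖ := by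
      rw [e]; exact intervalIntegral.norm_integral_le_integral_norm ht.1
    calc _ ≤ (∫ s in (0 : ℝ)..t, ‖D (S (max (t - s) 0) (f s))‖) ^ 2 :=
          pow_le_pow_left₀ (norm_nonneg _) h2 2
      _ ≤ t * ∫ s in (0 : ℝ)..t, q (t, s) := sq_integral_le hkt ht.1
      _ ≤ _ := mul_le_mul_of_nonneg_right ht.2
          (intervalIntegral.integral_nonneg ht.1 fun s _ => sq_nonneg _)
  have hqi : Continuous fun t => ∫ s in (0 : ℝ)..t, q (t, s) :=
    intervalIntegral.continuous_parametric_intervalIntegral_of_continuous hq continuous_id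
  have hqi2 : Continuous fun s => ∫ t in s..T, q (t, s) := by
    have := intervalIntegral.continuous_parametric_intervalIntegral_of_continuous
      (f := fun s t => q (t, s)) (a₀ := T) (μ := volume) (s := fun s => s)
      (hq.comp continuous_swap) continuous_id
    refine this.neg.congr fun s => ?_
    exact (intervalIntegral.integral_symm _ _).symm
  calc ∫ t in (0 : ℝ)..T, ‖D (convolution S f t)‖ ^ 2
      ≤ ∫ t in (0 : ℝ)..T, T * ∫ s in (0 : ℝ)..t, q (t, s) :=
        intervalIntegral.integral_mono_on hT
          (((D.continuous.comp (hS.continuous_convolution hf)).norm.pow 2).intervalIntegrable _ _)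
          ((continuous_const.mul hqi).intervalIntegrable _ _) h1
    _ = T * ∫ s in (0 : ℝ)..T, ∫ t in s..T, q (t, s) := by
        rw [intervalIntegral.integral_const_mul, integral_triangle_swap hq hT]
    _ ≤ T * ∫ s in (0 : ℝ)..T, c * ‖f s‖ ^ 2 := by
        refine mul_le_mul_of_nonneg_left ?_ hT
        refine intervalIntegral.integral_mono_on hT (hqi2.intervalIntegrable _ _)
          (Continuous.intervalIntegrable (by fun_prop) _ _) fun s hs => ?_
        refine le_trans ?_ (hD (f s))
        have hc : Continuous fun r => ‖D (S (max r 0) (f s))‖ ^ 2 :=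
          (D.continuous.comp (hS.continuous_orbit (f s))).norm.pow 2
        have e := intervalIntegral.integral_comp_sub_right
          (fun r => ‖D (S (max r 0) (f s))‖ ^ 2) s (a := s) (b := T)
        rw [sub_self] at e
        change ∫ t in s..T, ‖D (S (max (t - s) 0) (f s))‖ ^ 2 ≤ _
        rw [e]
        refine intervalIntegral.integral_mono_interval le_rfl (by linarith [hs.2])
          (by linarith [hs.1]) (ae_of_all _ fun r => sq_nonneg _) (hc.intervalIntegrable _ _)
    _ = _ := by rw [intervalIntegral.integral_const_mul]

/-- The mean `(1/h) ∫_0^h S(r) x dr` of an orbit. -/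
def IsC0Semigroup.orbitMean (hS : IsC0Semigroup S) (h : ℝ) : H →L[ℂ] H :=
  ((h⁻¹ : ℝ) : ℂ) • hS.orbitIntegral h

theorem IsC0Semigroup.tendsto_orbitMean (hS : IsC0Semigroup S) (x : H) :
    Tendsto (fun h => hS.orbitMean h x) (𝓝[>] 0) (𝓝 x) :=
  hS.tendsto_orbitIntegral x

theorem IsC0Semigroup.norm_orbitMean_le (hS : IsC0Semigroup S) {h M : ℝ} (h0 : 0 < h)
    (hM : ∀ t ∈ Icc 0 h, ‖S t‖ ≤ M) : ‖hS.orbitMean h‖ ≤ M := by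
  rw [orbitMean, norm_smul, Complex.norm_real, norm_inv, Real.norm_of_nonneg h0.le]
  calc _ ≤ h⁻¹ * (h * M) :=
        mul_le_mul_of_nonneg_left (hS.norm_orbitIntegral_le h0.le hM) (by positivity)
    _ = M := by field_simp

theorem IsC0Semigroup.orbitMean_mem_graph (hS : IsC0Semigroup S) (hG : IsGenerator G S) {h : ℝ}
    (h0 : 0 ≤ h) (x : H) :
    (hS.orbitMean h x, ((h⁻¹ : ℝ) : ℂ) • (S h x - x)) ∈ G.graph :=
  G.graph.smul_mem _ (hS.orbitIntegral_mem_graph hG h0 x)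

/-- On `D(G)` the mean commutes with `G`, so means converge in the graph norm as well. This is what
lets an unbounded observation be approximated by bounded ones. -/
theorem IsC0Semigroup.orbitMean_mem_graph_of_mem (hS : IsC0Semigroup S) (hG : IsGenerator G S)
    {h : ℝ} (h0 : 0 ≤ h) {x y : H} (hx : (x, y) ∈ G.graph) :
    (hS.orbitMean h x, hS.orbitMean h y) ∈ G.graph := by
  have := hS.orbitMean_mem_graph hG h0 x
  rwa [← hS.orbitIntegral_apply_generator hG hx h0] at this

theorem IsC0Semigroup.orbitMean_apply_comm (hS : IsC0Semigroup S) {h t : ℝ} (h0 : 0 ≤ h)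
    (ht : 0 ≤ t) (x : H) : hS.orbitMean h (S t x) = S t (hS.orbitMean h x) := by
  have e : hS.orbitIntegral h (S t x) = S t (hS.orbitIntegral h x) := by
    rw [hS.orbitIntegral_apply, hS.orbitIntegral_apply, ← (S t).intervalIntegral_comp_comm
      ((hS.continuous_orbit x).intervalIntegrable _ _)]
    exact intervalIntegral.integral_congr fun r _ => hS.commute (le_max_right _ _) ht x
  rw [orbitMean, _root_.smul_apply, _root_.smul_apply, e, map_smul]

/-- The bounded observation `x ↦ C ((1/h) ∫_0^h S(r) x dr)`. -/
def IsC0Semigroup.meanObservation (hS : IsC0Semigroup S) (hG : IsGenerator G S)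
    (C : GraphDomain G →L[ℂ] U) {h : ℝ} (h0 : 0 ≤ h) : H →L[ℂ] U where
  toFun x := C (GraphDomain.of G (hS.orbitMean h x))
  map_add' x y := by
    rw [_root_.map_add, GraphDomain.of_add, _root_.map_add]
    all_goals exact LinearPMap.mem_domain_of_mem_graph (hS.orbitMean_mem_graph hG h0 _)
  map_smul' c x := by
    rw [map_smul, GraphDomain.of_smul, map_smul, RingHom.id_apply]
    exact LinearPMap.mem_domain_of_mem_graph (hS.orbitMean_mem_graph hG h0 _)
  cont := by
    refine C.continuous.comp (continuousOn_univ.1 (GraphDomain.continuousOn_of G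
      (fun x _ => hS.orbitMean_mem_graph hG h0 x) (ContinuousLinearMap.continuous _).continuousOn
      (Continuous.continuousOn ?_)))
    fun_prop

/-- An `L²` bound for the observation of a convolution with values in the domain of the
generator. -/
theorem IsC0Semigroup.integral_observation_convolution_le (hS : IsC0Semigroup S)
    (hG : IsGenerator G S) (C : GraphDomain G →L[ℂ] U) {T c M : ℝ} (hT : 0 ≤ T) (hc0 : 0 ≤ c)
    (hM : ∀ t ∈ Icc 0 1, ‖S t‖ ≤ M)
    (hc : ∀ z ∈ G.domain, ∫ t in (0 : ℝ)..T, ‖C (GraphDomain.of G (S t z))‖ ^ 2 ≤ c * ‖z‖ ^ 2)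
    {f k : ℝ → H} (hf : Continuous f) (hk : ContinuousOn k (Icc 0 T))
    (hg : ∀ t ∈ Icc 0 T, (convolution S f t, k t) ∈ G.graph) :
    ∫ t in (0 : ℝ)..T, ‖C (GraphDomain.of G (convolution S f t))‖ ^ 2
      ≤ T * ((c * M ^ 2) * ∫ s in (0 : ℝ)..T, ‖f s‖ ^ 2) := by
  have hM0 : 0 ≤ M := (norm_nonneg _).trans (hM 0 (by simp))
  have hMh : ∀ h : ℝ, h ∈ Ioo 0 1 → ‖hS.orbitMean h‖ ≤ M := fun h hh =>
    hS.norm_orbitMean_le hh.1 fun t ht => hM t ⟨ht.1, ht.2.trans hh.2.le⟩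
  have hev : ∀ᶠ h : ℝ in 𝓝[>] 0, h ∈ Ioo 0 1 := Ioo_mem_nhdsGT zero_lt_one
  have hv := hS.continuous_convolution hf
  -- The observation `C` cannot be moved inside the convolution integral, since the integrand need
  -- not lie in `D(G)`. So `C` is first composed with the mean over `[0, h]`, which is bounded on
  -- all of `H`; dominated convergence then lets `h → 0`, with a majorant from the graph norm of the
  -- convolution.
  have hlim : Tendsto (fun h => ∫ t in (0 : ℝ)..T,
      ‖C (GraphDomain.of G (hS.orbitMean h (convolution S f t)))‖ ^ 2) (𝓝[>] 0)
      (𝓝 (∫ t in (0 : ℝ)..T, ‖C (GraphDomain.of G (convolution S f t))‖ ^ 2)) := by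
    refine intervalIntegral.tendsto_integral_filter_of_dominated_convergence
      (fun t => (‖C‖ * (M * (‖convolution S f t‖ + ‖k t‖))) ^ 2) ?_ ?_ ?_ ?_
    · filter_upwards [hev] with h hh
      exact (((hS.meanObservation hG C hh.1.le).continuous.comp
        hv).norm.pow 2).aestronglyMeasurable
    · filter_upwards [hev] with h hh
      refine ae_of_all _ fun t ht => ?_
      rw [uIoc_of_le hT] at ht
      have hm := hS.orbitMean_mem_graph_of_mem hG hh.1.le (hg t (Ioc_subset_Icc_self ht))
      rw [Real.norm_of_nonneg (sq_nonneg _)]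
      refine pow_le_pow_left₀ (norm_nonneg _) ((C.le_opNorm _).trans
        (mul_le_mul_of_nonneg_left ((GraphDomain.norm_le G _).trans ?_) (norm_nonneg _))) 2
      rw [GraphDomain.incl_of_graph G hm, GraphDomain.op_of G hm, mul_add]
      exact add_le_add
        ((hS.orbitMean h).le_of_opNorm_le (hMh h hh) _)
        ((hS.orbitMean h).le_of_opNorm_le (hMh h hh) _)
    · refine ContinuousOn.intervalIntegrable ?_
      rw [uIcc_of_le hT]
      exact (continuousOn_const.mul (continuousOn_const.mul
        (hv.norm.continuousOn.add hk.norm))).pow 2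
    · refine ae_of_all _ fun t ht => ?_
      rw [uIoc_of_le hT] at ht
      have hgt := hg t (Ioc_subset_Icc_self ht)
      refine (((C.continuous.tendsto _).comp
        ((GraphDomain.tendsto_nhds_iff G).2 ⟨?_, ?_⟩)).norm).pow 2
      · rw [GraphDomain.incl_of_graph G hgt]
        refine (hS.tendsto_orbitMean _).congr' ?_
        filter_upwards [hev] with h hh
        rw [GraphDomain.incl_of_graph G (hS.orbitMean_mem_graph hG hh.1.le _)]
      · rw [GraphDomain.op_of G hgt]
        refine (hS.tendsto_orbitMean _).congr' ?_
        filter_upwards [hev] with h hh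
        rw [GraphDomain.op_of G (hS.orbitMean_mem_graph_of_mem hG hh.1.le hgt)]
  refine le_of_tendsto hlim ?_
  filter_upwards [hev] with h hh
  refine hS.integral_norm_sq_convolution_le (hS.meanObservation hG C hh.1.le) hT (fun x => ?_) hf
  -- The mean commutes with the semigroup, so the regularized observation of the orbit of `x` is the
  -- original one of the orbit of its mean. The bound is therefore uniform in `h`, with constant `c
  -- M²`.
  have e : ∀ r ∈ uIcc 0 T, ‖hS.meanObservation hG C hh.1.le (S (max r 0) x)‖ ^ 2
      = ‖C (GraphDomain.of G (S r (hS.orbitMean h x)))‖ ^ 2 := fun r hr => by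
    rw [uIcc_of_le hT] at hr
    change ‖C (GraphDomain.of G (hS.orbitMean h (S (max r 0) x)))‖ ^ 2 = _
    rw [max_eq_left hr.1, hS.orbitMean_apply_comm hh.1.le hr.1]
  rw [intervalIntegral.integral_congr e]
  refine (hc _ (LinearPMap.mem_domain_of_mem_graph
    (hS.orbitMean_mem_graph hG hh.1.le x))).trans ?_
  rw [mul_assoc, ← mul_pow]
  exact mul_le_mul_of_nonneg_left (pow_le_pow_left₀ (norm_nonneg _)
    ((hS.orbitMean h).le_of_opNorm_le (hMh h hh) _) 2) hc0

end Observation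

/-- An operator dominated by a compact operator is compact. -/
theorem isCompactOperator_of_norm_le {E F G : Type*} [NormedAddCommGroup E] [NormedSpace ℂ E]
    [NormedAddCommGroup F] [NormedSpace ℂ F] [NormedAddCommGroup G] [NormedSpace ℂ G]
    [CompleteSpace G] {K : E →L[ℂ] F} (hK : IsCompactOperator K) {L : E →L[ℂ] G} {c : ℝ}
    (h : ∀ x, ‖L x‖ ≤ c * ‖K x‖) : IsCompactOperator L := by
  have hKc : TotallyBounded (K '' Metric.ball 0 1) :=
    (((isCompactOperator_iff_isCompact_closure_image_ball (K : E →ₗ[ℂ] F) one_pos).1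
      hK).totallyBounded).subset subset_closure
  refine (isCompactOperator_iff_isCompact_closure_image_ball (L : E →ₗ[ℂ] G) one_pos).2 ?_
  refine TotallyBounded.isCompact_of_isClosed (TotallyBounded.closure ?_) isClosed_closure
  rw [Metric.totallyBounded_iff]
  intro ε hε
  -- The centres of the net are chosen in the image under `K`. Their preimages are then mapped by
  -- `L` to an `ε`-net; `|c| + 1` avoids division by zero.
  obtain ⟨t, hts, htf, ht⟩ := Metric.finite_approx_of_totallyBounded hKc (ε / (|c| + 1))
    (by positivity)
  have hts' : ∀ y ∈ t, ∃ x, K x = y := fun y hy => (hts hy).imp fun _ hx => hx.2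
  choose! g hg using hts'
  refine ⟨(fun y => L (g y)) '' t, htf.image _, ?_⟩
  rintro _ ⟨x, hx, rfl⟩
  obtain ⟨y, hy, hxy⟩ := mem_iUnion₂.1 (ht ⟨x, hx, rfl⟩)
  refine mem_iUnion₂.2 ⟨_, ⟨y, hy, rfl⟩, ?_⟩
  have e : ‖K (x - g y)‖ < ε / (|c| + 1) := by
    rw [map_sub, hg y hy, ← dist_eq_norm]; exact hxy
  change dist (L x) (L (g y)) < ε
  rw [dist_eq_norm, ← map_sub]
  calc _ ≤ c * ‖K (x - g y)‖ := h _
    _ ≤ (|c| + 1) * ‖K (x - g y)‖ :=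
        mul_le_mul_of_nonneg_right ((le_abs_self c).trans (le_add_of_nonneg_right zero_le_one))
          (norm_nonneg _)
    _ < (|c| + 1) * (ε / (|c| + 1)) := mul_lt_mul_of_pos_left e (by positivity)
    _ = ε := by field_simp

/-! ### Time reversal of continuous functions as elements of L² -/

section TimeReversal

variable {U : Type*} [NormedAddCommGroup U]

theorem memLp_indicator_reverse {T : ℝ} {k : ℝ → U} (hk : ContinuousOn k (Icc 0 T)) :
    MemLp (indicator (Ioc 0 T) fun s => k (T - s)) 2 (volume.restrict (Ioi (0 : ℝ))) := by
  rw [memLp_indicator_iff_restrict measurableSet_Ioc, Measure.restrict_restrict measurableSet_Ioc]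
  have hr : ContinuousOn (fun s => k (T - s)) (Icc 0 T) :=
    hk.comp (by fun_prop) fun s hs => ⟨by linarith [hs.2], by linarith [hs.1]⟩
  obtain ⟨c, hc⟩ := isCompact_Icc.exists_bound_of_continuousOn hr
  have hsub : Ioc 0 T ∩ Ioi 0 ⊆ Icc 0 T := inter_subset_left.trans Ioc_subset_Icc_self
  have hm : MeasurableSet (Ioc 0 T ∩ Ioi (0 : ℝ)) := measurableSet_Ioc.inter measurableSet_Ioi
  have : IsFiniteMeasure (volume.restrict (Ioc 0 T ∩ Ioi (0 : ℝ))) :=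
    isFiniteMeasure_restrict.2
      ((measure_mono hsub).trans_lt isCompact_Icc.measure_lt_top).ne
  refine MemLp.of_bound ((hr.mono hsub).aestronglyMeasurable hm) c ?_
  exact (ae_restrict_mem hm).mono fun s hs => hc s (hsub hs)

/-- The element of `L²(0, +∞; U)` that equals `s ↦ k(T-s)` on `(0, T]` and vanishes elsewhere. -/
def timeReverse (T : ℝ) (k : ℝ → U) (hk : ContinuousOn k (Icc 0 T)) : InputSpace U :=
  (memLp_indicator_reverse hk).toLp _

theorem timeReverse_congr {T : ℝ} {k l : ℝ → U} (hk : ContinuousOn k (Icc 0 T))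
    (hl : ContinuousOn l (Icc 0 T)) (h : ∀ t ∈ Icc 0 T, k t = l t) :
    timeReverse T k hk = timeReverse T l hl := by
  have e : (indicator (Ioc 0 T) fun s => k (T - s)) = indicator (Ioc 0 T) fun s => l (T - s) :=
    indicator_congr fun s hs => h _ ⟨sub_nonneg.2 hs.2, sub_le_self _ hs.1.le⟩
  simp only [timeReverse, e]

theorem timeReverse_add {T : ℝ} {k l : ℝ → U} (hk : ContinuousOn k (Icc 0 T))
    (hl : ContinuousOn l (Icc 0 T)) :
    timeReverse T (fun s => k s + l s) (hk.add hl) = timeReverse T k hk + timeReverse T l hl := by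
  rw [timeReverse, timeReverse, timeReverse, ← MemLp.toLp_add]
  congr 1
  exact indicator_add _ _ _

theorem timeReverse_sub {T : ℝ} {k l : ℝ → U} (hk : ContinuousOn k (Icc 0 T))
    (hl : ContinuousOn l (Icc 0 T)) :
    timeReverse T (fun s => k s - l s) (hk.sub hl) = timeReverse T k hk - timeReverse T l hl := by
  rw [timeReverse, timeReverse, timeReverse, ← MemLp.toLp_sub]
  congr 1
  exact indicator_sub _ _ _

variable [InnerProductSpace ℂ U]

theorem timeReverse_smul {T : ℝ} {k : ℝ → U} (hk : ContinuousOn k (Icc 0 T)) (c : ℂ) :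
    timeReverse T (fun s => c • k s) (hk.const_smul c) = c • timeReverse T k hk := by
  rw [timeReverse, timeReverse, ← MemLp.toLp_const_smul]
  congr 1
  exact indicator_const_smul _ _ _

theorem inner_timeReverse {T : ℝ} (hT : 0 ≤ T) {k : ℝ → U} (hk : ContinuousOn k (Icc 0 T))
    (u : InputSpace U) :
    inner ℂ (timeReverse T k hk) u = ∫ s in (0 : ℝ)..T, inner ℂ (k (T - s)) (u s) := by
  rw [L2.inner_def]
  have h : (fun s => inner ℂ (timeReverse T k hk s) (u s))
      =ᵐ[volume.restrict (Ioi (0 : ℝ))]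
        indicator (Ioc 0 T) fun s => inner ℂ (k (T - s)) (u s) := by
    filter_upwards [(memLp_indicator_reverse hk).coeFn_toLp] with s hs
    rw [timeReverse, hs]
    by_cases h : s ∈ Ioc 0 T
    · rw [indicator_of_mem h, indicator_of_mem h]
    · rw [indicator_of_notMem h, indicator_of_notMem h, inner_zero_left]
  rw [integral_congr_ae h, setIntegral_indicator measurableSet_Ioc,
    inter_eq_right.2 Ioc_subset_Ioi_self, intervalIntegral.integral_of_le hT]

theorem norm_sq_timeReverse {T : ℝ} (hT : 0 ≤ T) {k : ℝ → U} (hk : ContinuousOn k (Icc 0 T)) :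
    ‖timeReverse T k hk‖ ^ 2 = ∫ s in (0 : ℝ)..T, ‖k s‖ ^ 2 := by
  have h1 := inner_timeReverse hT hk (timeReverse T k hk)
  have h2 : ∀ᵐ s ∂volume, s ∈ Ioc 0 T → inner ℂ (k (T - s)) (timeReverse T k hk s)
      = ((‖k (T - s)‖ ^ 2 : ℝ) : ℂ) := by
    have := (ae_restrict_iff' measurableSet_Ioi).1 (memLp_indicator_reverse hk).coeFn_toLp
    filter_upwards [this] with s hs hsT
    rw [timeReverse, hs hsT.1, indicator_of_mem hsT, inner_self_eq_norm_sq_to_K]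
    norm_cast
  rw [intervalIntegral.integral_congr_ae (by rwa [uIoc_of_le hT]), intervalIntegral.integral_ofReal,
    inner_self_eq_norm_sq_to_K] at h1
  have h3 := intervalIntegral.integral_comp_sub_left (fun s => ‖k s‖ ^ 2) T (a := 0) (b := T)
  rw [sub_self, sub_zero] at h3
  rw [← h3]
  exact RCLike.ofReal_injective (K := ℂ) (by rw [RCLike.ofReal_pow]; exact h1)

end TimeReversal

/-! ### Duality between input maps and observations -/

section InputMap

variable {H U : Type*} [NormedAddCommGroup H] [InnerProductSpace ℂ H] [CompleteSpace H]
  [NormedAddCommGroup U] [InnerProductSpace ℂ U] {A : H →ₗ.[ℂ] H}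

theorem isInputMap_inputMap {B : U →L[ℂ] AdjointDomainDual A} {T : ℝ}
    (h : ∃ Φ : InputSpace U →L[ℂ] H, IsInputMap A B T Φ) :
    IsInputMap A B T (inputMap A B T) := by
  rw [inputMap, dif_pos h]
  exact h.choose_spec

variable [CompleteSpace U]

/-- The observation `t ↦ B* S_A(t)* z`. -/
def observation (A : H →ₗ.[ℂ] H) (B : U →L[ℂ] AdjointDomainDual A) (z : H) (t : ℝ) : U :=
  controlAdjoint B (GraphDomain.of A.adjoint (adjointSemigroup (semigroup A) t z))

theorem isC0Semigroup_adjoint (hA : GeneratesC0Semigroup A) :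
    IsC0Semigroup (adjointSemigroup (semigroup A)) :=
  (semigroup_spec hA).1.adjoint (semigroup_spec hA).2

theorem isGenerator_adjoint (hA : GeneratesC0Semigroup A) :
    IsGenerator A.adjoint (adjointSemigroup (semigroup A)) :=
  (semigroup_spec hA).2.adjoint (semigroup_spec hA).1

theorem continuousOn_observation (hA : GeneratesC0Semigroup A)
    (B : U →L[ℂ] AdjointDomainDual A) (T : ℝ) (z : GraphDomain A.adjoint) :
    ContinuousOn (observation A B (GraphDomain.incl A.adjoint z)) (Icc 0 T) :=
  ((isC0Semigroup_adjoint hA).continuousOn_observation (isGenerator_adjoint hA)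
    (controlAdjoint B) (GraphDomain.incl_mem _ z)).mono Icc_subset_Ici_self

/-- The output map `z ↦ 1_{(0,T]}(s) B* S_A(T-s)* z`, defined on `D(A*)`. -/
def outputMap (hA : GeneratesC0Semigroup A) (B : U →L[ℂ] AdjointDomainDual A) (T : ℝ)
    (z : GraphDomain A.adjoint) : InputSpace U :=
  timeReverse T _ (continuousOn_observation hA B T z)

/-- This duality trades the input integral, which a priori lives in `D(A*)'`, for the observation of
the adjoint semigroup, a continuous function with values in `U`. -/
theorem inner_outputMap (hA : GeneratesC0Semigroup A) (B : U →L[ℂ] AdjointDomainDual A) {T : ℝ}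
    (hT : 0 ≤ T) (z : GraphDomain A.adjoint) (u : InputSpace U) :
    inner ℂ (outputMap hA B T z) u = inputFunctional A B T u z := by
  rw [outputMap, inner_timeReverse hT]
  exact intervalIntegral.integral_congr fun s _ => inner_controlAdjoint B _ _

theorem norm_sq_outputMap (hA : GeneratesC0Semigroup A) (B : U →L[ℂ] AdjointDomainDual A) {T : ℝ}
    (hT : 0 ≤ T) (z : GraphDomain A.adjoint) :
    ‖outputMap hA B T z‖ ^ 2
      = ∫ t in (0 : ℝ)..T, ‖observation A B (GraphDomain.incl A.adjoint z) t‖ ^ 2 :=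
  norm_sq_timeReverse hT _

theorem adjointSemigroup_incl_mem (hA : GeneratesC0Semigroup A) (z : GraphDomain A.adjoint)
    {t : ℝ} (ht : 0 ≤ t) :
    adjointSemigroup (semigroup A) t (GraphDomain.incl A.adjoint z) ∈ A.adjoint.domain :=
  adjoint_semigroup_mem hA ht (GraphDomain.incl_mem _ z)

theorem outputMap_add (hA : GeneratesC0Semigroup A) (B : U →L[ℂ] AdjointDomainDual A)
    {T : ℝ} (z w : GraphDomain A.adjoint) :
    outputMap hA B T (z + w) = outputMap hA B T z + outputMap hA B T w := by
  rw [outputMap, outputMap, outputMap, ← timeReverse_add]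
  refine timeReverse_congr _ _ fun t ht => ?_
  simp only [observation]
  rw [map_add, map_add, GraphDomain.of_add _ (adjointSemigroup_incl_mem hA z ht.1)
    (adjointSemigroup_incl_mem hA w ht.1), map_add]

theorem outputMap_smul (hA : GeneratesC0Semigroup A) (B : U →L[ℂ] AdjointDomainDual A)
    {T : ℝ} (c : ℂ) (z : GraphDomain A.adjoint) :
    outputMap hA B T (c • z) = c • outputMap hA B T z := by
  rw [outputMap, outputMap, ← timeReverse_smul]
  refine timeReverse_congr _ _ fun t ht => ?_
  simp only [observation]
  rw [map_smul, map_smul, GraphDomain.of_smul _ _ (adjointSemigroup_incl_mem hA z ht.1), map_smul]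

theorem denseRange_incl_adjoint (hA : GeneratesC0Semigroup A) :
    DenseRange (GraphDomain.incl A.adjoint) := by
  have := (semigroup_spec hA).1.dense_adjoint_domain (semigroup_spec hA).2
  have e : range (GraphDomain.incl A.adjoint) = (A.adjoint.domain : Set H) := Subtype.range_val
  rwa [DenseRange, e]

/-- The observation inequality
`∫_0^T ‖B* S_A(t)* z‖² dt ≤ c ‖z‖²`, `z ∈ D(A*)`. -/
def ObservationBound (A : H →ₗ.[ℂ] H) (B : U →L[ℂ] AdjointDomainDual A) (T c : ℝ) : Prop :=
  ∀ z ∈ A.adjoint.domain, ∫ t in (0 : ℝ)..T, ‖observation A B z t‖ ^ 2 ≤ c * ‖z‖ ^ 2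

/-- Admissibility implies the observation inequality on some time interval. -/
theorem IsAdmissible.exists_observationBound {B : U →L[ℂ] AdjointDomainDual A}
    (hB : IsAdmissible A B) (hA : GeneratesC0Semigroup A) :
    ∃ T c : ℝ, 0 < T ∧ 0 ≤ c ∧ ObservationBound A B T c := by
  obtain ⟨T, hT, h⟩ := hB
  -- The functionals are indexed by `z ∈ D(A*)` in the unit ball of `H`, not of the graph norm. For
  -- fixed `u` they are bounded by `‖y‖`, because admissibility represents the input integral by
  -- some `y ∈ H`. Uniform boundedness yields the estimate in the norm of `H`.
  obtain ⟨c, hc⟩ := banach_steinhaus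
    (ι := {z : GraphDomain A.adjoint // ‖GraphDomain.incl A.adjoint z‖ ≤ 1})
    (g := fun z => innerSL ℂ (outputMap hA B T z.1)) (fun u => by
      obtain ⟨y, hy⟩ := h u
      refine ⟨‖y‖, fun z => ?_⟩
      rw [innerSL_apply_apply, inner_outputMap hA B hT.le, ← hy]
      exact (norm_inner_le_norm _ _).trans (mul_le_of_le_one_left (norm_nonneg _) z.2))
  refine ⟨T, c ^ 2, hT, sq_nonneg c, fun z hz => ?_⟩
  have e : GraphDomain.incl A.adjoint (GraphDomain.of A.adjoint z) = z := GraphDomain.incl_of _ hz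
  have hle : ‖outputMap hA B T (GraphDomain.of A.adjoint z)‖ ≤ c * ‖z‖ := by
    rcases eq_or_ne z 0 with rfl | h0
    · have : GraphDomain.of A.adjoint 0 = (0 : ℂ) • GraphDomain.of A.adjoint (0 : H) := by
        rw [← GraphDomain.of_smul _ _ hz, smul_zero]
      rw [this, outputMap_smul, zero_smul, norm_zero, norm_zero, mul_zero]
    · have hz0 : 0 < ‖z‖ := norm_pos_iff.2 h0
      have h1 := hc ⟨((‖z‖⁻¹ : ℝ) : ℂ) • GraphDomain.of A.adjoint z, by
        rw [map_smul, e, norm_smul, Complex.norm_real, norm_inv, norm_norm,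
          inv_mul_cancel₀ hz0.ne']⟩
      rw [innerSL_apply_norm, outputMap_smul, norm_smul, Complex.norm_real, norm_inv,
        norm_norm] at h1
      rwa [inv_mul_le_iff₀ hz0, mul_comm] at h1
  have h2 := norm_sq_outputMap hA B hT.le (GraphDomain.of A.adjoint z)
  rw [e] at h2
  rw [← h2, ← mul_pow]
  exact pow_le_pow_left₀ (norm_nonneg _) hle 2

theorem ObservationBound.exists_of_pos (hA : GeneratesC0Semigroup A)
    {B : U →L[ℂ] AdjointDomainDual A} {T₀ c₀ : ℝ} (hT₀ : 0 < T₀) (hc₀ : 0 ≤ c₀)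
    (h : ObservationBound A B T₀ c₀) {T : ℝ} (hT : 0 ≤ T) :
    ∃ c : ℝ, 0 ≤ c ∧ ObservationBound A B T c :=
  (isC0Semigroup_adjoint hA).exists_observation_bound (isGenerator_adjoint hA) (controlAdjoint B)
    hT₀ hc₀ h hT

/-- Under the observation inequality the input map is well defined. -/
theorem ObservationBound.exists_isInputMap (hA : GeneratesC0Semigroup A)
    {B : U →L[ℂ] AdjointDomainDual A} {T c : ℝ} (hT : 0 ≤ T) (h : ObservationBound A B T c) :
    ∃ Φ : InputSpace U →L[ℂ] H, IsInputMap A B T Φ := by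
  let O : GraphDomain A.adjoint →ₗ[ℂ] InputSpace U :=
    { toFun := outputMap hA B T
      map_add' := outputMap_add hA B
      map_smul' := outputMap_smul hA B }
  have hO : ∃ C, ∀ z, ‖O z‖ ≤ C * ‖GraphDomain.incl A.adjoint z‖ := by
    refine ⟨Real.sqrt |c|, fun z => ?_⟩
    have h1 := h _ (GraphDomain.incl_mem _ z)
    rw [← norm_sq_outputMap hA B hT] at h1
    refine le_of_sq_le_sq (b := Real.sqrt |c| * ‖GraphDomain.incl A.adjoint z‖) ?_ (by positivity)
    rw [mul_pow, Real.sq_sqrt (abs_nonneg _)]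
    exact h1.trans (mul_le_mul_of_nonneg_right (le_abs_self c) (sq_nonneg _))
  -- The inequality says that the output map is bounded for the norm of `H`. It extends from the
  -- dense `D(A*)` to `H`, and the adjoint of the extension is the input map.
  refine ⟨ContinuousLinearMap.adjoint (O.extendOfNorm (GraphDomain.incl A.adjoint)),
    fun u z => ?_⟩
  rw [ContinuousLinearMap.adjoint_inner_right,
    LinearMap.extendOfNorm_eq (denseRange_incl_adjoint hA) hO]
  exact inner_outputMap hA B hT z u

/-- Through this identity the norm of a difference of adjoint input maps becomes an `L²` norm of a
difference of observations. -/
theorem IsInputMap.adjoint_apply (hA : GeneratesC0Semigroup A)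
    {B : U →L[ℂ] AdjointDomainDual A} {T : ℝ} (hT : 0 ≤ T) {Φ : InputSpace U →L[ℂ] H}
    (h : IsInputMap A B T Φ) (z : GraphDomain A.adjoint) :
    ContinuousLinearMap.adjoint Φ (GraphDomain.incl A.adjoint z) = outputMap hA B T z := by
  refine ext_inner_right ℂ fun u => ?_
  rw [ContinuousLinearMap.adjoint_inner_left, h u z, inner_outputMap hA B hT]

end InputMap

/-! ### Paths in the domain, continuous in the graph norm -/

section GraphPath

variable {H U : Type*} [NormedAddCommGroup H] [InnerProductSpace ℂ H]
  [NormedAddCommGroup U] [InnerProductSpace ℂ U] {G : H →ₗ.[ℂ] H} {v w : ℝ → H}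

/-- `v` is a path in `D(G)` for nonnegative times, continuous in the graph norm. -/
def IsGraphPath (G : H →ₗ.[ℂ] H) (v : ℝ → H) : Prop :=
  Continuous v ∧ ∃ k : ℝ → H, Continuous k ∧ ∀ t, 0 ≤ t → (v t, k t) ∈ G.graph

theorem IsGraphPath.mem_domain (hv : IsGraphPath G v) {t : ℝ} (ht : 0 ≤ t) : v t ∈ G.domain := by
  obtain ⟨-, k, -, h⟩ := hv
  exact LinearPMap.mem_domain_of_mem_graph (h t ht)

theorem IsGraphPath.sub (hv : IsGraphPath G v) (hw : IsGraphPath G w) :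
    IsGraphPath G fun t => v t - w t := by
  obtain ⟨hv, k, hk, h⟩ := hv
  obtain ⟨hw, l, hl, h'⟩ := hw
  exact ⟨hv.sub hw, fun t => k t - l t, hk.sub hl, fun t ht => G.graph.sub_mem (h t ht) (h' t ht)⟩

theorem IsGraphPath.congr (hv : IsGraphPath G v) (hw : Continuous w)
    (h : ∀ t, 0 ≤ t → w t = v t) : IsGraphPath G w := by
  obtain ⟨-, k, hk, hg⟩ := hv
  exact ⟨hw, k, hk, fun t ht => by rw [h t ht]; exact hg t ht⟩

theorem IsGraphPath.continuousOn_comp (hv : IsGraphPath G v) (C : GraphDomain G →L[ℂ] U) (T : ℝ) :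
    ContinuousOn (fun t => C (GraphDomain.of G (v t))) (Icc 0 T) := by
  obtain ⟨hv, k, hk, h⟩ := hv
  exact C.continuous.comp_continuousOn
    (GraphDomain.continuousOn_of G (fun t ht => h t ht.1) hv.continuousOn hk.continuousOn)

theorem IsGraphPath.intervalIntegrable_norm_sq (hv : IsGraphPath G v) (C : GraphDomain G →L[ℂ] U)
    {T : ℝ} (hT : 0 ≤ T) :
    IntervalIntegrable (fun t => ‖C (GraphDomain.of G (v t))‖ ^ 2) volume 0 T := by
  refine ContinuousOn.intervalIntegrable ?_
  rw [uIcc_of_le hT]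
  exact (hv.continuousOn_comp C T).norm.pow 2

theorem norm_add_sq_le_two_mul {E : Type*} [SeminormedAddCommGroup E] (a b : E) :
    ‖a + b‖ ^ 2 ≤ 2 * ‖a‖ ^ 2 + 2 * ‖b‖ ^ 2 := by
  have h := norm_add_le a b
  nlinarith [norm_nonneg (a + b), sq_nonneg (‖a‖ - ‖b‖)]

/-- `∫ ‖C (v + w)‖² ≤ 2 ∫ ‖C v‖² + 2 ∫ ‖C w‖²`. -/
theorem IsGraphPath.integral_norm_sq_le {u : ℝ → H} (hu : IsGraphPath G u) (hv : IsGraphPath G v)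
    (hw : IsGraphPath G w) (C : GraphDomain G →L[ℂ] U) {T : ℝ} (hT : 0 ≤ T)
    (h : ∀ t, 0 ≤ t → u t = v t + w t) :
    ∫ t in (0 : ℝ)..T, ‖C (GraphDomain.of G (u t))‖ ^ 2
      ≤ 2 * (∫ t in (0 : ℝ)..T, ‖C (GraphDomain.of G (v t))‖ ^ 2)
        + 2 * ∫ t in (0 : ℝ)..T, ‖C (GraphDomain.of G (w t))‖ ^ 2 := by
  have hvi := (hv.intervalIntegrable_norm_sq C hT).const_mul 2
  have hwi := (hw.intervalIntegrable_norm_sq C hT).const_mul 2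
  rw [← intervalIntegral.integral_const_mul, ← intervalIntegral.integral_const_mul,
    ← intervalIntegral.integral_add hvi hwi]
  refine intervalIntegral.integral_mono_on hT (hu.intervalIntegrable_norm_sq C hT)
    (hvi.add hwi) fun t ht => ?_
  rw [h t ht.1, GraphDomain.of_add G (hv.mem_domain ht.1) (hw.mem_domain ht.1), map_add]
  exact norm_add_sq_le_two_mul _ _

end GraphPath

/-! ### Comparison of the perturbed and unperturbed observations -/

section Perturbation

variable {H U : Type*} [NormedAddCommGroup H] [InnerProductSpace ℂ H] [CompleteSpace H]
  {A : H →ₗ.[ℂ] H}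

/-- The orbit `t ↦ S_A(t)* z`, extended by a constant to negative times. -/
def adjointPath (A : H →ₗ.[ℂ] H) (z : H) (t : ℝ) : H :=
  adjointSemigroup (semigroup A) (max t 0) z

theorem adjointPath_of_nonneg (A : H →ₗ.[ℂ] H) (z : H) {t : ℝ} (ht : 0 ≤ t) :
    adjointPath A z t = adjointSemigroup (semigroup A) t z := by
  rw [adjointPath, max_eq_left ht]

/-- The path `t ↦ ∫_0^t S_A(t-s)* P* y(s) ds`. -/
def volterraPath (A : H →ₗ.[ℂ] H) (P : H →L[ℂ] H) (y : ℝ → H) : ℝ → H :=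
  convolution (adjointSemigroup (semigroup A)) fun s => ContinuousLinearMap.adjoint P (y s)

/-- For `t ≥ 0` all times that occur are nonnegative, so the clamps have no effect; the clamped
version has the advantage of being continuous on the whole line. -/
theorem volterra_adjointOrbit_eq (A : H →ₗ.[ℂ] H) (P : H →L[ℂ] H) (z : H) {t : ℝ} (ht : 0 ≤ t) :
    volterra A P (adjointOrbit A z) t = volterraPath A P (adjointPath A z) t := by
  refine intervalIntegral.integral_congr fun s hs => ?_
  rw [uIcc_of_le ht] at hs
  simp only [adjointOrbit, adjointPath, adjointSemigroup, max_eq_left hs.1,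
    max_eq_left (sub_nonneg.2 hs.2)]

theorem continuous_adjointPath (hA : GeneratesC0Semigroup A) (z : H) :
    Continuous (adjointPath A z) :=
  (isC0Semigroup_adjoint hA).continuous_orbit z

theorem continuous_volterraPath (hA : GeneratesC0Semigroup A) (P : H →L[ℂ] H) {y : ℝ → H}
    (hy : Continuous y) : Continuous (volterraPath A P y) :=
  (isC0Semigroup_adjoint hA).continuous_convolution
    ((ContinuousLinearMap.continuous _).comp hy)

theorem volterraPath_sub (hA : GeneratesC0Semigroup A) (P : H →L[ℂ] H) {y x : ℝ → H}
    (hy : Continuous y) (hx : Continuous x) (t : ℝ) :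
    volterraPath A P (fun s => y s - x s) t = volterraPath A P y t - volterraPath A P x t := by
  simp only [volterraPath, map_sub]
  exact (isC0Semigroup_adjoint hA).convolution_sub
    ((ContinuousLinearMap.adjoint P).continuous.comp hy)
    ((ContinuousLinearMap.adjoint P).continuous.comp hx) t

theorem isGraphPath_adjointPath (hA : GeneratesC0Semigroup A) {z : H}
    (hz : z ∈ A.adjoint.domain) : IsGraphPath A.adjoint (adjointPath A z) := by
  obtain ⟨w, hw⟩ := LinearPMap.mem_domain_iff.1 hz
  exact ⟨continuous_adjointPath hA z, adjointPath A w, continuous_adjointPath hA w, fun t _ =>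
    (isC0Semigroup_adjoint hA).apply_mem_graph (isGenerator_adjoint hA) (le_max_right _ _) hw⟩

theorem isGraphPath_adjointPath_perturb (hA : GeneratesC0Semigroup A) (P : H →L[ℂ] H) {z : H}
    (hz : z ∈ A.adjoint.domain) : IsGraphPath A.adjoint (adjointPath (perturb A P) z) := by
  rw [← perturb_adjoint_domain A P] at hz
  obtain ⟨h1, k, hk, h⟩ := isGraphPath_adjointPath (hA.perturb P) hz
  exact ⟨h1, _, hk.sub ((ContinuousLinearMap.adjoint P).continuous.comp h1), fun t ht =>
    (mem_graph_perturb_adjoint_iff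
      ((semigroup_spec hA).1.dense_domain (semigroup_spec hA).2) P).1 (h t ht)⟩

/-- For `z ∈ D(A*)` the source `P* S_A(·)* z` is continuously differentiable in time, and that
regularity puts the convolution into `D(A*)`. `P*` need not preserve `D(A*)`. -/
theorem isGraphPath_volterraPath (hA : GeneratesC0Semigroup A) (P : H →L[ℂ] H) {z : H}
    (hz : z ∈ A.adjoint.domain) :
    IsGraphPath A.adjoint (volterraPath A P (adjointPath A z)) := by
  obtain ⟨w, hw⟩ := LinearPMap.mem_domain_iff.1 hz
  have hS' := isC0Semigroup_adjoint hA
  have hc : ∀ x, Continuous fun s => ContinuousLinearMap.adjoint P (adjointPath A x s) := fun x =>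
    (ContinuousLinearMap.continuous _).comp (continuous_adjointPath hA x)
  refine ⟨continuous_volterraPath hA P (continuous_adjointPath hA z),
    fun t => adjointPath A (ContinuousLinearMap.adjoint P (adjointPath A z 0)) t
      - ContinuousLinearMap.adjoint P (adjointPath A z t)
      + volterraPath A P (adjointPath A w) t,
    ((continuous_adjointPath hA _).sub (hc z)).add
      (continuous_volterraPath hA P (continuous_adjointPath hA w)), fun t ht => ?_⟩
  have := convolution_adjoint_mem_graph (semigroup_spec hA).1 (semigroup_spec hA).2 (hc z) (hc w)
    ht fun s hs => by
      have h1 := hS'.hasDerivAt_orbit (isGenerator_adjoint hA) hw hs.1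
      have h2 := (((ContinuousLinearMap.adjoint P).restrictScalars ℝ).hasFDerivAt
        (x := adjointPath A z s)).comp_hasDerivAt s h1
      refine h2.congr_deriv ?_
      rw [adjointPath, max_eq_left hs.1.le]
      rfl
  rwa [← adjointPath_of_nonneg A _ ht] at this

theorem adjointPath_perturb_eq (hA : GeneratesC0Semigroup A) (P : H →L[ℂ] H) {z : H}
    (hz : z ∈ A.adjoint.domain) {t : ℝ} (ht : 0 ≤ t) :
    adjointPath (perturb A P) z t
      = adjointPath A z t + volterraPath A P (adjointPath (perturb A P) z) t := by
  rw [← perturb_adjoint_domain A P] at hz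
  obtain ⟨w, hw⟩ := LinearPMap.mem_domain_iff.1 hz
  have hA₂ := semigroup_spec (hA.perturb P)
  have := duhamel_adjoint (semigroup_spec hA).1 (semigroup_spec hA).2 hA₂.1 hA₂.2 hw ht
  rw [adjointPath_of_nonneg _ _ ht, adjointPath_of_nonneg _ _ ht]
  exact this

variable [NormedAddCommGroup U] [InnerProductSpace ℂ U] [CompleteSpace U]

/-- The convolution estimate with source `P* y`. Since `y` is a general continuous path, membership
of `V y` in `D(A*)` has to be assumed, yet the constant depends on neither `y` nor a graph norm. -/
theorem integral_observation_volterraPath_le (hA : GeneratesC0Semigroup A)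
    (B : U →L[ℂ] AdjointDomainDual A) (P : H →L[ℂ] H) {T c : ℝ} (hT : 0 ≤ T) (hc0 : 0 ≤ c)
    (hc : ObservationBound A B T c) :
    ∃ c' : ℝ, 0 ≤ c' ∧ ∀ y : ℝ → H, Continuous y → IsGraphPath A.adjoint (volterraPath A P y) →
      ∫ t in (0 : ℝ)..T,
        ‖controlAdjoint B (GraphDomain.of A.adjoint (volterraPath A P y t))‖ ^ 2
        ≤ c' * ∫ t in (0 : ℝ)..T, ‖y t‖ ^ 2 := by
  obtain ⟨M, hM0, hM⟩ := (isC0Semigroup_adjoint hA).exists_bound 1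
  set p := ‖ContinuousLinearMap.adjoint P‖
  refine ⟨T * ((c * M ^ 2) * p ^ 2), by positivity, fun y hy hg => ?_⟩
  obtain ⟨-, k, hk, hg⟩ := hg
  have hPy : Continuous fun s => ContinuousLinearMap.adjoint P (y s) :=
    (ContinuousLinearMap.continuous _).comp hy
  refine ((isC0Semigroup_adjoint hA).integral_observation_convolution_le (isGenerator_adjoint hA)
    (controlAdjoint B) hT hc0 hM hc hPy hk.continuousOn (fun t ht => hg t ht.1)).trans ?_
  have h : ∫ t in (0 : ℝ)..T, ‖ContinuousLinearMap.adjoint P (y t)‖ ^ 2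
      ≤ p ^ 2 * ∫ t in (0 : ℝ)..T, ‖y t‖ ^ 2 := by
    rw [← intervalIntegral.integral_const_mul]
    refine intervalIntegral.integral_mono_on hT ((hPy.norm.pow 2).intervalIntegrable _ _)
      ((continuous_const.mul (hy.norm.pow 2)).intervalIntegrable _ _) fun s _ => ?_
    rw [← mul_pow]
    exact pow_le_pow_left₀ (norm_nonneg _) (ContinuousLinearMap.le_opNorm _ _) 2
  calc _ ≤ T * ((c * M ^ 2) * (p ^ 2 * ∫ t in (0 : ℝ)..T, ‖y t‖ ^ 2)) := by gcongr
    _ = _ := by ring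

/-- The two adjoint domains have the same elements and `B` acts on them in the same way, so both
observations can be compared inside `D(A*)`. -/
theorem observation_perturb_eq (hA : GeneratesC0Semigroup A) (B : U →L[ℂ] AdjointDomainDual A)
    (P : H →L[ℂ] H) {z : H} (hz : z ∈ A.adjoint.domain) {t : ℝ} (ht : 0 ≤ t) :
    observation (perturb A P) (perturbControl B P) z t
      = controlAdjoint B (GraphDomain.of A.adjoint (adjointPath (perturb A P) z t)) := by
  have e : ∀ x, controlAdjoint (perturbControl B P) x
      = controlAdjoint B (perturbDomain A P x) := fun x => by
    refine ext_inner_right ℂ fun u => ?_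
    rw [inner_controlAdjoint, inner_controlAdjoint]; rfl
  rw [← perturb_adjoint_domain A P] at hz
  have hm := (isGraphPath_adjointPath (hA.perturb P) hz).mem_domain ht
  have hm' : adjointPath (perturb A P) z t ∈ A.adjoint.domain := by
    rwa [perturb_adjoint_domain A P] at hm
  have e2 : perturbDomain A P (GraphDomain.of _ (adjointPath (perturb A P) z t))
      = GraphDomain.of A.adjoint (adjointPath (perturb A P) z t) := by
    refine GraphDomain.incl_injective _ ?_
    rw [GraphDomain.incl_of _ hm']
    exact GraphDomain.incl_of _ hm
  rw [observation, e, ← e2, adjointPath_of_nonneg _ _ ht]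

theorem observation_eq (B : U →L[ℂ] AdjointDomainDual A) (z : H) {t : ℝ} (ht : 0 ≤ t) :
    observation A B z t
      = controlAdjoint B (GraphDomain.of A.adjoint (adjointPath A z t)) := by
  rw [observation, adjointPath_of_nonneg _ _ ht]

/-- The observation inequality is stable under bounded perturbations. -/
theorem ObservationBound.perturb (hA : GeneratesC0Semigroup A)
    {B : U →L[ℂ] AdjointDomainDual A} (P : H →L[ℂ] H) {T c : ℝ} (hT : 0 ≤ T) (hc0 : 0 ≤ c)
    (hc : ObservationBound A B T c) :
    ∃ c₂ : ℝ, 0 ≤ c₂ ∧ ObservationBound (perturb A P) (perturbControl B P) T c₂ := by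
  obtain ⟨c', hc'0, hc'⟩ := integral_observation_volterraPath_le hA B P hT hc0 hc
  obtain ⟨M, hM0, hM⟩ := (isC0Semigroup_adjoint (hA.perturb P)).exists_bound T
  -- Duhamel's formula splits the perturbed orbit. The free part costs `c`; the Volterra part costs
  -- `c'` times the squared `L²` norm of the perturbed orbit, at most `T M² ‖z‖²`.
  refine ⟨2 * c + 2 * (c' * (T * M ^ 2)), by positivity, fun z hz => ?_⟩
  rw [perturb_adjoint_domain A P] at hz
  have hz1 := isGraphPath_adjointPath hA hz
  have hz2 := isGraphPath_adjointPath_perturb hA P hz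
  -- No smoothness of the source is needed here: by Duhamel this Volterra term is the difference of
  -- two orbits that both stay in `D(A*)`.
  have hV : IsGraphPath A.adjoint (volterraPath A P (adjointPath (ControlSystem.perturb A P) z)) :=
    (hz2.sub hz1).congr (continuous_volterraPath hA P hz2.1) fun t ht => by
      rw [adjointPath_perturb_eq hA P hz ht, add_sub_cancel_left]
  have e1 : ∫ t in (0 : ℝ)..T,
      ‖observation (ControlSystem.perturb A P) (perturbControl B P) z t‖ ^ 2
      = ∫ t in (0 : ℝ)..T, ‖controlAdjoint B
        (GraphDomain.of A.adjoint (adjointPath (ControlSystem.perturb A P) z t))‖ ^ 2 := by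
    refine intervalIntegral.integral_congr fun t ht => ?_
    rw [uIcc_of_le hT] at ht
    simp only [observation_perturb_eq hA B P hz ht.1]
  have e2 : ∫ t in (0 : ℝ)..T, ‖observation A B z t‖ ^ 2
      = ∫ t in (0 : ℝ)..T, ‖controlAdjoint B
        (GraphDomain.of A.adjoint (adjointPath A z t))‖ ^ 2 := by
    refine intervalIntegral.integral_congr fun t ht => ?_
    rw [uIcc_of_le hT] at ht
    simp only [observation_eq B z ht.1]
  have h3 : ∫ t in (0 : ℝ)..T, ‖adjointPath (ControlSystem.perturb A P) z t‖ ^ 2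
      ≤ T * M ^ 2 * ‖z‖ ^ 2 := by
    have : ∫ t in (0 : ℝ)..T, ‖adjointPath (ControlSystem.perturb A P) z t‖ ^ 2
        ≤ ∫ _ in (0 : ℝ)..T, (M * ‖z‖) ^ 2 := by
      refine intervalIntegral.integral_mono_on hT ((hz2.1.norm.pow 2).intervalIntegrable _ _)
        (continuous_const.intervalIntegrable _ _) fun t ht => ?_
      exact pow_le_pow_left₀ (norm_nonneg _) (ContinuousLinearMap.le_of_opNorm_le _
        (hM _ ⟨le_max_right _ _, max_le ht.2 hT⟩) z) 2
    rw [intervalIntegral.integral_const, smul_eq_mul, sub_zero, mul_pow] at this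
    linarith
  have h4 := hz2.integral_norm_sq_le hz1 hV (controlAdjoint B) hT
    fun t ht => adjointPath_perturb_eq hA P hz ht
  have h5 := hc z hz
  have h6 := hc' _ hz2.1 hV
  have h7 := mul_le_mul_of_nonneg_left h3 hc'0
  rw [e1]
  rw [e2] at h5
  linarith

/-- The `L²` norm of `S_{A+P}(t)* z - S_A(t)* z` is controlled by that of `V S_A(·)* z`. -/
theorem integral_norm_sq_sub_adjointPath_le (hA : GeneratesC0Semigroup A) (P : H →L[ℂ] H) {T : ℝ}
    (hT : 0 ≤ T) :
    ∃ c : ℝ, 0 ≤ c ∧ ∀ z ∈ A.adjoint.domain,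
      ∫ t in (0 : ℝ)..T, ‖adjointPath (perturb A P) z t - adjointPath A z t‖ ^ 2
        ≤ c * ∫ t in (0 : ℝ)..T, ‖volterraPath A P (adjointPath A z) t‖ ^ 2 := by
  obtain ⟨M, hM0, hM⟩ := (isC0Semigroup_adjoint hA).exists_bound T
  set p := ‖ContinuousLinearMap.adjoint P‖
  set L := M * p * Real.exp (M * p * T)
  refine ⟨2 + 2 * (L ^ 2 * T) * T, by positivity, fun z hz => ?_⟩
  have hc1 := continuous_adjointPath hA z
  have hc2 := continuous_adjointPath (hA.perturb P) z
  set w : ℝ → H := fun t => adjointPath (perturb A P) z t - adjointPath A z t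
  set a : ℝ → ℝ := fun t => ‖volterraPath A P (adjointPath A z) t‖
  have hw : Continuous w := hc2.sub hc1
  have ha : Continuous a := (continuous_volterraPath hA P hc1).norm
  have hPw : Continuous fun s => ContinuousLinearMap.adjoint P (w s) :=
    (ContinuousLinearMap.continuous _).comp hw
  -- Subtracting the free orbit turns Duhamel's formula into an equation for `w` whose source `V
  -- S_A(·)* z` is the quantity that the hypothesis of the main theorem controls.
  have heq : ∀ t, 0 ≤ t → w t = volterraPath A P (adjointPath A z) t + volterraPath A P w t := by
    intro t ht
    rw [volterraPath_sub hA P hc2 hc1, add_sub_cancel]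
    simp only [w]
    rw [adjointPath_perturb_eq hA P hz ht, add_sub_cancel_left]
  have hG : ∀ t ∈ Icc 0 T, ‖w t‖ ≤ a t
      + M * p * (Real.exp (M * p * T) * ∫ s in (0 : ℝ)..T, a s) := by
    intro t ht
    refine gronwall_integral ha hw.norm (by positivity) (fun _ _ => norm_nonneg _)
      (fun s hs => ?_) ht
    calc ‖w s‖ ≤ a s + ‖volterraPath A P w s‖ := by rw [heq s hs.1]; exact norm_add_le _ _
      _ ≤ a s + M * ∫ r in (0 : ℝ)..s, ‖ContinuousLinearMap.adjoint P (w r)‖ :=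
          add_le_add le_rfl ((isC0Semigroup_adjoint hA).norm_convolution_le hPw hM hs)
      _ ≤ a s + M * ∫ r in (0 : ℝ)..s, p * ‖w r‖ := by
          gcongr
          exact intervalIntegral.integral_mono_on hs.1 (hPw.norm.intervalIntegrable _ _)
            ((continuous_const.mul hw.norm).intervalIntegrable _ _)
            fun r _ => ContinuousLinearMap.le_opNorm _ _
      _ = _ := by rw [intervalIntegral.integral_const_mul]; ring
  have hCS := sq_integral_le ha hT
  set I := ∫ s in (0 : ℝ)..T, a s ^ 2
  -- Gronwall bounds `w` by `a` plus `L` times its `L¹` norm, and Cauchy–Schwarz turns the latter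
  -- into the `L²` norm.
  have hpt : ∀ t ∈ Icc 0 T, ‖w t‖ ^ 2 ≤ 2 * a t ^ 2 + 2 * (L ^ 2 * (T * I)) := by
    intro t ht
    have h1 : ‖w t‖ ≤ a t + L * ∫ s in (0 : ℝ)..T, a s := by
      have := hG t ht
      rwa [← mul_assoc] at this
    have h2 : ‖w t‖ ^ 2 ≤ (a t + L * ∫ s in (0 : ℝ)..T, a s) ^ 2 :=
      pow_le_pow_left₀ (norm_nonneg _) h1 2
    have h3 := mul_le_mul_of_nonneg_left hCS (sq_nonneg L)
    nlinarith [sq_nonneg (a t - L * ∫ s in (0 : ℝ)..T, a s)]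
  calc ∫ t in (0 : ℝ)..T, ‖w t‖ ^ 2
      ≤ ∫ t in (0 : ℝ)..T, (2 * a t ^ 2 + 2 * (L ^ 2 * (T * I))) :=
        intervalIntegral.integral_mono_on hT ((hw.norm.pow 2).intervalIntegrable _ _)
          (Continuous.intervalIntegrable (by fun_prop) _ _) hpt
    _ = 2 * I + T * (2 * (L ^ 2 * (T * I))) := by
        rw [intervalIntegral.integral_add (Continuous.intervalIntegrable (by fun_prop) _ _)
          (Continuous.intervalIntegrable (by fun_prop) _ _), intervalIntegral.integral_const_mul,
          intervalIntegral.integral_const, sub_zero, smul_eq_mul]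
    _ = _ := by ring

/-- The difference of the observations of the perturbed and of the unperturbed adjoint semigroup is
controlled by `V S_A(·)* z`. -/
theorem integral_norm_sq_sub_observation_le (hA : GeneratesC0Semigroup A)
    {B : U →L[ℂ] AdjointDomainDual A} (P : H →L[ℂ] H) {T c : ℝ} (hT : 0 ≤ T) (hc0 : 0 ≤ c)
    (hc : ObservationBound A B T c) :
    ∃ C : ℝ, 0 ≤ C ∧ ∀ z ∈ A.adjoint.domain,
      ∫ t in (0 : ℝ)..T, ‖observation A B z t
          - observation (perturb A P) (perturbControl B P) z t‖ ^ 2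
        ≤ C * ((∫ t in (0 : ℝ)..T, ‖controlAdjoint B (GraphDomain.of A.adjoint
            (volterra A P (adjointOrbit A z) t))‖ ^ 2)
          + ∫ t in (0 : ℝ)..T, ‖volterra A P (adjointOrbit A z) t‖ ^ 2) := by
  obtain ⟨c', hc'0, hc'⟩ := integral_observation_volterraPath_le hA B P hT hc0 hc
  obtain ⟨d, hd0, hd⟩ := integral_norm_sq_sub_adjointPath_le hA P hT
  -- The term `B* V S_A(·)* z` enters with factor `2`. The term `B* V w` is bounded first by `w`
  -- (factor `c'`), then by `V S_A(·)* z` (factor `d`).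
  refine ⟨2 + 2 * (c' * d), by positivity, fun z hz => ?_⟩
  have hz1 := isGraphPath_adjointPath hA hz
  have hz2 := isGraphPath_adjointPath_perturb hA P hz
  have hV1 := isGraphPath_volterraPath hA P hz
  have hw := hz2.sub hz1
  have heq : ∀ t, 0 ≤ t → adjointPath (perturb A P) z t - adjointPath A z t
      = volterraPath A P (adjointPath A z) t
        + volterraPath A P (fun t => adjointPath (perturb A P) z t - adjointPath A z t) t := by
    intro t ht
    rw [volterraPath_sub hA P hz2.1 hz1.1, add_sub_cancel, adjointPath_perturb_eq hA P hz ht,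
      add_sub_cancel_left]
  -- `V w` lies in `D(A*)` because it equals `w - V S_A(·)* z`, and both of these do.
  have hVw : IsGraphPath A.adjoint
      (volterraPath A P fun t => adjointPath (perturb A P) z t - adjointPath A z t) :=
    (hw.sub hV1).congr (continuous_volterraPath hA P hw.1) fun t ht =>
      (sub_eq_of_eq_add' (heq t ht)).symm
  have e1 : ∫ t in (0 : ℝ)..T, ‖observation A B z t
        - observation (perturb A P) (perturbControl B P) z t‖ ^ 2
      = ∫ t in (0 : ℝ)..T, ‖controlAdjoint B (GraphDomain.of A.adjoint
          (adjointPath (perturb A P) z t - adjointPath A z t))‖ ^ 2 := by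
    refine intervalIntegral.integral_congr fun t ht => ?_
    rw [uIcc_of_le hT] at ht
    rw [observation_perturb_eq hA B P hz ht.1, observation_eq B z ht.1,
      GraphDomain.of_sub _ (hz2.mem_domain ht.1) (hz1.mem_domain ht.1), map_sub, norm_sub_rev]
  have e2 : ∫ t in (0 : ℝ)..T, ‖controlAdjoint B (GraphDomain.of A.adjoint
        (volterra A P (adjointOrbit A z) t))‖ ^ 2
      = ∫ t in (0 : ℝ)..T, ‖controlAdjoint B (GraphDomain.of A.adjoint
        (volterraPath A P (adjointPath A z) t))‖ ^ 2 := by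
    refine intervalIntegral.integral_congr fun t ht => ?_
    rw [uIcc_of_le hT] at ht
    simp only [volterra_adjointOrbit_eq A P z ht.1]
  have e3 : ∫ t in (0 : ℝ)..T, ‖volterra A P (adjointOrbit A z) t‖ ^ 2
      = ∫ t in (0 : ℝ)..T, ‖volterraPath A P (adjointPath A z) t‖ ^ 2 := by
    refine intervalIntegral.integral_congr fun t ht => ?_
    rw [uIcc_of_le hT] at ht
    simp only [volterra_adjointOrbit_eq A P z ht.1]
  rw [e1, e2, e3]
  have h1 := hw.integral_norm_sq_le hV1 hVw (controlAdjoint B) hT heq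
  have h2 := (hc' _ hw.1 hVw).trans (mul_le_mul_of_nonneg_left (hd z hz) hc'0)
  set X := ∫ t in (0 : ℝ)..T, ‖controlAdjoint B (GraphDomain.of A.adjoint
        (volterraPath A P (adjointPath A z) t))‖ ^ 2
  set Y := ∫ t in (0 : ℝ)..T, ‖volterraPath A P (adjointPath A z) t‖ ^ 2
  have hX : 0 ≤ X := intervalIntegral.integral_nonneg hT fun _ _ => sq_nonneg _
  have hY : 0 ≤ Y := intervalIntegral.integral_nonneg hT fun _ _ => sq_nonneg _
  have hcd : 0 ≤ c' * d * X := by positivity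
  linarith

end Perturbation

end

end ControlSystem

/-! ### Conclusion: admissibility and compactness -/

theorem mainTheorem8 {H U : Type*}
    [NormedAddCommGroup H] [InnerProductSpace ℂ H] [CompleteSpace H]
    [NormedAddCommGroup U] [InnerProductSpace ℂ U] [CompleteSpace U]
    (A₁ : H →ₗ.[ℂ] H) (hA₁ : GeneratesC0Semigroup A₁)
    (B : U →L[ℂ] AdjointDomainDual A₁) (hB : IsAdmissible A₁ B)
    (P : H →L[ℂ] H)
    (hV : ∀ T : ℝ, 0 < T →
      ∃ (K : Type*) (_ : NormedAddCommGroup K) (_ : InnerProductSpace ℂ K) (_ : CompleteSpace K)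
        (F : H →L[ℂ] K) (C : ℝ), IsCompactOperator F ∧ 0 < C ∧
        ∀ z₀ ∈ A₁.adjoint.domain,
          (∫ t in (0 : ℝ)..T, ‖controlAdjoint B
              (GraphDomain.of A₁.adjoint (volterra A₁ P (adjointOrbit A₁ z₀) t))‖ ^ 2)
            + (∫ t in (0 : ℝ)..T, ‖volterra A₁ P (adjointOrbit A₁ z₀) t‖ ^ 2)
          ≤ C * ‖F z₀‖ ^ 2) :
    GeneratesC0Semigroup (perturb A₁ P) ∧
    IsAdmissible (perturb A₁ P) (perturbControl B P) ∧
    ∀ T : ℝ, 0 < T →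
      IsInputMap A₁ B T (inputMap A₁ B T) ∧
      IsInputMap (perturb A₁ P) (perturbControl B P) T
        (inputMap (perturb A₁ P) (perturbControl B P) T) ∧
      IsCompactOperator
        (ContinuousLinearMap.adjoint (inputMap A₁ B T)
          - ContinuousLinearMap.adjoint (inputMap (perturb A₁ P) (perturbControl B P) T)) := by
  have hA₂ := hA₁.perturb P
  obtain ⟨T₀, c₀, hT₀, hc₀, h₀⟩ := hB.exists_observationBound hA₁
  have hbound : ∀ T : ℝ, 0 ≤ T → ∃ c : ℝ, 0 ≤ c ∧ ObservationBound A₁ B T c := fun T hT =>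
    h₀.exists_of_pos hA₁ hT₀ hc₀ hT
  have hmap₂ : ∀ T : ℝ, 0 ≤ T → ∃ Φ, IsInputMap (perturb A₁ P) (perturbControl B P) T Φ := by
    intro T hT
    obtain ⟨c, hc0, hc⟩ := hbound T hT
    obtain ⟨c₂, -, hc₂⟩ := hc.perturb hA₁ P hT hc0
    exact hc₂.exists_isInputMap hA₂ hT
  refine ⟨hA₂, ?_, fun T hT => ?_⟩
  -- Any positive time would serve as witness.
  · obtain ⟨Φ, hΦ⟩ := hmap₂ 1 zero_le_one
    exact ⟨1, one_pos, fun u => ⟨Φ u, hΦ u⟩⟩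
  · obtain ⟨c, hc0, hc⟩ := hbound T hT.le
    have h₁ := isInputMap_inputMap (hc.exists_isInputMap hA₁ hT.le)
    have h₂ := isInputMap_inputMap (hmap₂ T hT.le)
    refine ⟨h₁, h₂, ?_⟩
    obtain ⟨K, _, _, _, F, C, hF, hC, hFV⟩ := hV T hT
    obtain ⟨C', hC'0, hC'⟩ := integral_norm_sq_sub_observation_le hA₁ P hT.le hc0 hc
    set L := ContinuousLinearMap.adjoint (inputMap A₁ B T)
      - ContinuousLinearMap.adjoint (inputMap (perturb A₁ P) (perturbControl B P) T)
    -- On `D(A₁*)` both adjoint input maps are explicit time-reversed observations. The square of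
    -- `‖L z‖` is therefore the integral estimated by `hC'`, and `hFV` bounds it by `F`.
    have hL : ∀ z ∈ A₁.adjoint.domain, ‖L z‖ ≤ Real.sqrt (C' * C) * ‖F z‖ := by
      intro z hz
      have hz₂ : z ∈ (perturb A₁ P).adjoint.domain := by rwa [perturb_adjoint_domain A₁ P]
      have e₁ := h₁.adjoint_apply hA₁ hT.le (GraphDomain.of _ z)
      have e₂ := h₂.adjoint_apply hA₂ hT.le (GraphDomain.of _ z)
      have e : L z = outputMap hA₁ B T (GraphDomain.of _ z)
          - outputMap hA₂ (perturbControl B P) T (GraphDomain.of _ z) := by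
        rw [← e₁, ← e₂, GraphDomain.incl_of _ hz, GraphDomain.incl_of _ hz₂]
        rfl
      refine le_of_sq_le_sq (b := Real.sqrt (C' * C) * ‖F z‖) ?_ (by positivity)
      rw [mul_pow, Real.sq_sqrt (by positivity), e, outputMap, outputMap, ← timeReverse_sub,
        norm_sq_timeReverse hT.le]
      simp only [GraphDomain.incl_of _ hz, GraphDomain.incl_of _ hz₂]
      calc _ ≤ C' * _ := hC' z hz
        _ ≤ C' * (C * ‖F z‖ ^ 2) := mul_le_mul_of_nonneg_left (hFV z hz) hC'0
        _ = _ := by ring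
    have hdense := (semigroup_spec hA₁).1.dense_adjoint_domain (semigroup_spec hA₁).2
    refine isCompactOperator_of_norm_le hF (c := Real.sqrt (C' * C)) fun z => ?_
    -- The domination by `F` is a closed condition on `z`, so it passes from the dense domain to all
    -- of `H`.
    exact (isClosed_le L.continuous.norm (continuous_const.mul F.continuous.norm)).closure_subset_iff.2
      hL (hdense z)
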